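/- **Notation.** For $r\in\mathbb R$ put $\langle r\rangle=(1+|r|^2)^{1/2}$. Let $\mathcal S'(\mathbb R^2)$ be the space of tempered distributions on $\mathbb R^2$, with coordinates $(\alpha,\beta)$, and let $\mathcal F$ be the Fourier transform on it. For $a,b\in\mathbb R$ and a tempered distribution $u$ whose Fourier transform is a function, put $$\|u\|_{H_\alpha^aH_\beta^b}=\|u\|_{H_\beta^bH_\alpha^a}=\Big(\int_{\mathbb R^2}\langle\tau\rangle^{2a}\langle\xi\rangle^{2b}\,|[\mathcal F u](\tau,\xi)|^2\,d\tau\,d\xi\Big)^{1/2}.$$ Let $\mathbb H^{s,\delta}=H_\alpha^sH_\beta^\delta\cap H_\beta^sH_\alpha^\delta$ be the space of $\mathbb R^2$-valued tempered distributions $u$ on $\mathbb R^2$ for which $$\|u\|_{\mathbb H^{s,\delta}}=\Big(\|u\|_{H_\alpha^sH_\beta^\delta}^2+\|u\|_{H_\beta^sH_\alpha^\delta}^2\Big)^{1/2}$$ is finite. For $s,\delta\ge 0$ its elements are ($L^2$-) functions, so $\sigma\circ u$ is defined almost everywhere for $u\in\mathbb H^{s,\delta}$. Let $\mathcal C_b^k(\mathbb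 R^2)$ be the space of $k$ times continuously differentiable maps $\sigma:\mathbb R^2\to\mathbb R^2$ that are bounded together with their derivatives up to order $k$, with norm $\|\sigma\|_{\mathcal C_b^k}=\sum_{j\le k}\sup_x\|D^j\sigma(x)\|$. **Proposition 4.2 (DiffusionTerm).** Let $\frac34<\delta\le s<1$. There are functions $C_1,C_2:[0,\infty)\to[0,\infty)$, depending only on $s$ and $\delta$, such that for every $\sigma\in\mathcal C_b^3(\mathbb R^2)$ the following hold. 1. If $\sigma(0)=0$, then for every $u\in\mathbb H^{s,\delta}$ one has $\sigma\circ u\in\mathbb H^{s,\delta}$ and $$\|\sigma\circ u\|_{\mathbb H^{s,\delta}}^2\le C_1\big(\|\sigma\|_{\mathcal C_b^2}\big)\,\|u\|_{\mathbb H^{s,\delta}}^2\,\Big[1+\|u\|_{\mathbb H^{s,\delta}}^2\Big].$$ 2. For all $u_1,u_2\in\mathbb H^{s,\delta}$ one has $\sigma\circ u_1-\sigma\circ u_2\in\mathbb H^{s,\delta}$ and $$\|\sigma\circ u_1-\sigma\circ u_2\|_{\mathbb H^{s,\delta}}^2\le C_2\big(\|\sigma\|_{\mathcal C_b^3}\big)\,\|u_2-u_1\|_{\mathbb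 H^{s,\delta}}^2\,\Big[1+\sum_{i,k=1}^{2}\|u_i\|_{\mathbb H^{s,\delta}}^{2k}\Big].$$ -/

import Mathlib

open scoped SchwartzMap ENNReal NNReal FourierTransform
open MeasureTheory

namespace ProductSobolev

/-- The plane `ℝ²`. It is the space of the null coordinates `(α, β) = (x 0, x 1)`, the space of the
dual variables `(τ, ξ) = (ζ 0, ζ 1)`, and the target of the functions under consideration. -/
abbrev Plane : Type := EuclideanSpace ℝ (Fin 2)

/-- The complexified target `ℂ²`, with its Euclidean norm. -/
abbrev CPlane : Type := EuclideanSpace ℂ (Fin 2)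

/-- The inclusion `ℝ² ⊆ ℂ²`. -/
noncomputable def toCPlane (v : Plane) : CPlane := WithLp.toLp 2 fun i => ((v i : ℝ) : ℂ)

/-- The tempered distribution `T` is the (regular) distribution given by the function `g`:
`T φ = ∫ φ g` for all Schwartz functions `φ`, the integrals being absolutely convergent.
Such a `g` is unique up to equality almost everywhere. -/
def IsGivenBy (T : 𝓢'(Plane, CPlane)) (g : Plane → CPlane) : Prop :=
  AEStronglyMeasurable g volume ∧
    ∀ φ : 𝓢(Plane, ℂ), Integrable (fun x => φ x • g x) volume ∧ T φ = ∫ x, φ x • g x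

/-- The tempered distribution `T` is `ℝ²`-valued: on real test functions it takes real values. -/
def IsReal (T : 𝓢'(Plane, CPlane)) : Prop :=
  ∀ φ : 𝓢(Plane, ℂ), (∀ x, (φ x).im = 0) → ∀ i, (T φ i).im = 0

/-- `⟨r⟩ = (1 + |r|²)^{1/2}`. -/
noncomputable def japaneseBracket (r : ℝ) : ℝ := Real.sqrt (1 + |r| ^ 2)

/-- The norm of `H_α^a H_β^b`:
`(∫ ⟨τ⟩^{2a} ⟨ξ⟩^{2b} |(𝓕 T)(τ, ξ)|² dτ dξ)^{1/2}`. Its value is `∞` if `𝓕 T` is not a function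
(the infimum is over the almost everywhere unique function that gives `𝓕 T`, if there is one) or
if the integral is infinite. The norm of `H_β^b H_α^a` is the same. -/
noncomputable def prodNorm (a b : ℝ) (T : 𝓢'(Plane, CPlane)) : ℝ≥0∞ :=
  ⨅ (g : Plane → CPlane) (_ : IsGivenBy (𝓕 T) g),
    (∫⁻ ζ : Plane, ENNReal.ofReal
        (japaneseBracket (ζ 0) ^ (2 * a) * japaneseBracket (ζ 1) ^ (2 * b)) * ‖g ζ‖ₑ ^ 2)
      ^ (1 / 2 : ℝ)

/-- The norm of `ℍ^{s,δ} = H_α^s H_β^δ ∩ H_β^s H_α^δ`. -/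
noncomputable def hNorm (s δ : ℝ) (T : 𝓢'(Plane, CPlane)) : ℝ≥0∞ :=
  (prodNorm s δ T ^ 2 + prodNorm δ s T ^ 2) ^ (1 / 2 : ℝ)

/-- The tempered distribution `T` is an element of the space `ℍ^{s,δ}` of `ℝ²`-valued
distributions on `ℝ²`. -/
def MemH (s δ : ℝ) (T : 𝓢'(Plane, CPlane)) : Prop :=
  IsReal T ∧ hNorm s δ T < ∞

/-- `v = σ ∘ u`: the distribution `u` is given by a function `f : ℝ² → ℝ²`, and `v` is the
distribution given by the function `σ ∘ f`. -/
def IsComposition (σ : Plane → Plane) (u v : 𝓢'(Plane, CPlane)) : Prop :=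
  ∃ f : Plane → Plane, AEStronglyMeasurable f volume ∧
    IsGivenBy u (fun x => toCPlane (f x)) ∧ IsGivenBy v (fun x => toCPlane (σ (f x)))

/-- The norm of `C_b^k`: the sum over `j ≤ k` of the supremum norms of the `j`-th derivatives. -/
noncomputable def cbNorm (k : ℕ) (σ : Plane → Plane) : ℝ≥0∞ :=
  ∑ j ∈ Finset.range (k + 1), ⨆ x, ‖iteratedFDeriv ℝ j σ x‖ₑ

/-- `σ ∈ C_b^k`: `σ` is `k` times continuously differentiable, and it and its derivatives up to
order `k` are bounded. -/
def MemCb (k : ℕ) (σ : Plane → Plane) : Prop :=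
  ContDiff ℝ k σ ∧ cbNorm k σ < ∞

end ProductSobolev

open ProductSobolev

namespace ProductSobolev

open Filter Topology Metric

/-! For 0 < a, b < 1, Plancherel turns the norm of H_α^a H_β^b into one built from differences. Up
to constants its square is the sum of ‖F‖², of ∫ ‖Δ_h F‖² dh/|h|^{1+2a} with step h in α, of the
analogue with step k in β and exponent b, and of the mixed term in Δ_h Δ_k F, all norms being L².
The reason is that this sum has the Fourier symbol (1 + c_a|τ|^{2a})(1 + c_b|ξ|^{2b}); see
`IsFourierPair.diffNorm_eq` and `exists_prodNorm_bounds`. Differences, unlike the Fourier transform,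
can be followed through a composition point by point.

First differences of σ∘F are controlled by the Lipschitz bound. The mixed difference obeys |Δ_hΔ_k
σ(F)| ≲ |Δ_hΔ_k F| + |Δ_h F||Δ_k F| (`norm_four_point_le`), and the product is the only term that is
not linear in F. Since b > 1/2, the one-dimensional Sobolev embedding in β puts Δ_h F in L²_α L^∞_β;
since a > 1/2, the one in α puts Δ_k F in L^∞_α L²_β. Their product is in L², with a bound that is a
function of h times a function of k, so integration over h and k yields the product of two full
norms (`exists_lintegral_diffFst_mul_diffSnd_le`). This is the source of the factor 1 + ‖u‖².

For σ∘F₁ - σ∘F₂ the same scheme is run along the segment from F₂ to F₁ (`norm_diff_four_point_le`),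
at the cost of a third derivative of σ. Terms in which w = F₁ - F₂ appears without a difference
operator need its sup norm, which the embedding of H_α^a H_β^b in L^∞ bounds by the norm of w. Both
estimates are applied with (a, b) = (s, δ) and (δ, s) and added. -/

/-- The measure `|h|^{-1-2a} dh` of fractional difference quotients. -/
noncomputable def fracMeasure (a : ℝ) : Measure ℝ :=
  volume.withDensity fun h => ENNReal.ofReal (|h| ^ (-(1 + 2 * a)))

theorem measurable_fracWeight (a : ℝ) :
    Measurable fun h : ℝ => ENNReal.ofReal (|h| ^ (-(1 + 2 * a))) := by
  fun_prop

instance (a : ℝ) : SFinite (fracMeasure a) := by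
  unfold fracMeasure; infer_instance

theorem lintegral_fracMeasure (a : ℝ) {φ : ℝ → ℝ≥0∞} (hφ : Measurable φ) :
    ∫⁻ h, φ h ∂(fracMeasure a) = ∫⁻ h, ENNReal.ofReal (|h| ^ (-(1 + 2 * a))) * φ h := by
  rw [fracMeasure, lintegral_withDensity_eq_lintegral_mul _ (measurable_fracWeight a) hφ]
  rfl

/-! ### One-dimensional Sobolev embedding by dyadic averages. -/

section OneDim

variable {E : Type*} [NormedAddCommGroup E] [NormedSpace ℝ E] [CompleteSpace E]
  [MeasurableSpace E] [BorelSpace E] [SecondCountableTopology E]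

-- Jensen's inequality for the squared norm, in the form that the L¹ norm is at most the L² norm on
-- a probability space.
omit [MeasurableSpace E] [BorelSpace E] [SecondCountableTopology E] in
theorem enorm_integral_sub_sq_le {α : Type*} [MeasurableSpace α] (P : Measure α)
    [IsProbabilityMeasure P] {f : α → E} (hf : Integrable f P) (c : E) :
    ‖(∫ x, f x ∂P) - c‖ₑ ^ 2 ≤ ∫⁻ x, ‖f x - c‖ₑ ^ 2 ∂P := by
  have h1 : (∫ x, f x ∂P) - c = ∫ x, (f x - c) ∂P := by
    rw [integral_sub hf (integrable_const c)]; simp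
  have hm : AEStronglyMeasurable (fun x => f x - c) P :=
    hf.aestronglyMeasurable.sub aestronglyMeasurable_const
  have h2 : ‖∫ x, (f x - c) ∂P‖ₑ ≤ eLpNorm (fun x => f x - c) 2 P := by
    refine (enorm_integral_le_lintegral_enorm _).trans ?_
    rw [← eLpNorm_one_eq_lintegral_enorm]
    exact eLpNorm_le_eLpNorm_of_exponent_le (by norm_num) hm
  rw [h1]
  refine (pow_le_pow_left' h2 2).trans (le_of_eq ?_)
  rw [eLpNorm_eq_lintegral_rpow_enorm_toReal (by norm_num) (by norm_num)]
  simp only [ENNReal.toReal_ofNat]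
  rw [← ENNReal.rpow_natCast, ← ENNReal.rpow_mul]
  norm_num

-- Two points of a ball of radius r are at distance at most 2r, so the weight |y - z|^{-(1+2a)} is
-- at least (2r)^{-(1+2a)} and can be inserted at that price.
omit [NormedSpace ℝ E] [CompleteSpace E] in
theorem setLIntegral_enorm_sub_sq_le {a : ℝ} (ha : 0 < a) {f : ℝ → E} (hf : Measurable f)
    (x : ℝ) {r : ℝ} (hr : 0 < r) {s t : Set ℝ} (hs : s ⊆ closedBall x r) (hsm : MeasurableSet s)
    (htm : MeasurableSet t) (ht : t ⊆ closedBall x r) :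
    ∫⁻ z in s, ∫⁻ y in t, ‖f y - f z‖ₑ ^ 2 ≤
      ENNReal.ofReal ((2 * r) ^ (1 + 2 * a)) *
        ∫⁻ h, (∫⁻ y, ‖f (y + h) - f y‖ₑ ^ 2) ∂(fracMeasure a) := by
  have hm : Measurable fun p : ℝ × ℝ => ‖f (p.1 + p.2) - f p.1‖ₑ ^ 2 := by fun_prop
  have hm' : Measurable fun p : ℝ × ℝ => ‖f (p.2 + p.1) - f p.2‖ₑ ^ 2 := by fun_prop
  have key : ∀ z ∈ s, ∫⁻ y in t, ‖f y - f z‖ₑ ^ 2 ≤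
      ENNReal.ofReal ((2 * r) ^ (1 + 2 * a)) *
        ∫⁻ h, ENNReal.ofReal (|h| ^ (-(1 + 2 * a))) * ‖f (z + h) - f z‖ₑ ^ 2 := by
    intro z hz
    rw [← lintegral_indicator htm, ← lintegral_add_left_eq_self _ z, ← lintegral_const_mul _
      (by fun_prop)]
    -- The real power gives the weight the value 0 at h = 0, so the lower bound on the weight is
    -- used off this null set.
    have h0 : ∀ᵐ h : ℝ, h ≠ 0 := by simp [ae_iff]
    refine lintegral_mono_ae ?_
    filter_upwards [h0] with h hh
    by_cases hzt : z + h ∈ t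
    · rw [Set.indicator_of_mem hzt, ← mul_assoc, ← ENNReal.ofReal_mul (by positivity)]
      have hh' : 0 < |h| := abs_pos.2 hh
      have h1 : |h| ≤ 2 * r := by
        have h2 := mem_closedBall.1 (ht hzt)
        have h3 := mem_closedBall.1 (hs hz)
        rw [Real.dist_eq] at h2 h3
        have : h = (z + h - x) - (z - x) := by ring
        rw [this]
        exact (abs_sub _ _).trans (by linarith)
      have h2 : 1 ≤ (2 * r) ^ (1 + 2 * a) * |h| ^ (-(1 + 2 * a)) := by
        rw [Real.rpow_neg hh'.le, ← div_eq_mul_inv, one_le_div (by positivity)]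
        exact Real.rpow_le_rpow hh'.le h1 (by linarith)
      calc _ = 1 * ‖f (z + h) - f z‖ₑ ^ 2 := by rw [one_mul]
        _ ≤ _ := by
          gcongr
          simpa using ENNReal.ofReal_le_ofReal h2
    · rw [Set.indicator_of_notMem hzt]; exact zero_le
  calc _ ≤ ∫⁻ z in s, ENNReal.ofReal ((2 * r) ^ (1 + 2 * a)) *
        ∫⁻ h, ENNReal.ofReal (|h| ^ (-(1 + 2 * a))) * ‖f (z + h) - f z‖ₑ ^ 2 :=
        setLIntegral_mono_ae' hsm (.of_forall key)
    _ ≤ ∫⁻ z, ENNReal.ofReal ((2 * r) ^ (1 + 2 * a)) *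
        ∫⁻ h, ENNReal.ofReal (|h| ^ (-(1 + 2 * a))) * ‖f (z + h) - f z‖ₑ ^ 2 :=
        setLIntegral_le_lintegral _ _
    _ = ENNReal.ofReal ((2 * r) ^ (1 + 2 * a)) * ∫⁻ z, ∫⁻ h, ‖f (z + h) - f z‖ₑ ^ 2
          ∂(fracMeasure a) := by
        have : ∀ z, ∫⁻ h, ‖f (z + h) - f z‖ₑ ^ 2 ∂(fracMeasure a) =
            ∫⁻ h, ENNReal.ofReal (|h| ^ (-(1 + 2 * a))) * ‖f (z + h) - f z‖ₑ ^ 2 :=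
          fun z => lintegral_fracMeasure a (by fun_prop)
        simp_rw [← this]
        rw [lintegral_const_mul]
        exact hm.lintegral_prod_right'
    _ = _ := by
        congr 1
        exact lintegral_lintegral_swap
          (f := fun z h => ‖f (z + h) - f z‖ₑ ^ 2) hm.aemeasurable

/-- The one-dimensional Sobolev embedding `H^a ⊆ L^∞`, `a > 1/2`, in terms of differences. -/
theorem exists_ae_enorm_sq_le {a : ℝ} (ha : 1 / 2 < a) : ∃ K : ℝ≥0, ∀ f : ℝ → E, Measurable f →
    ∀ᵐ x, ‖f x‖ₑ ^ 2 ≤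
      K * ((∫⁻ y, ‖f y‖ₑ ^ 2) + ∫⁻ h, (∫⁻ y, ‖f (y + h) - f y‖ₑ ^ 2) ∂(fracMeasure a)) := by
  -- θ = 2^{-(a - 1/2)} is the ratio by which averages over balls of radius 2^{-n} improve; it is
  -- less than 1 because a > 1/2, and B is the sum of the resulting geometric series.
  set θ : ℝ := (1 / 2) ^ ((2 * a - 1) / 2) with hθ
  have hθ0 : 0 < θ := by positivity
  have hθ1 : θ < 1 := Real.rpow_lt_one (by norm_num) (by norm_num) (by linarith)
  set B : ℝ := 2 ^ a / (1 - θ) with hB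
  have hB0 : 0 < B := by have := sub_pos.2 hθ1; positivity
  refine ⟨Real.toNNReal (2 + 2 * B ^ 2), fun f hf => ?_⟩
  set N := ∫⁻ y, ‖f y‖ₑ ^ 2 with hN
  set G := ∫⁻ h, (∫⁻ y, ‖f (y + h) - f y‖ₑ ^ 2) ∂(fracMeasure a) with hG
  have hK : (1 : ℝ) ≤ 2 + 2 * B ^ 2 := by nlinarith [sq_nonneg B]
  by_cases hfin : N + G = ∞
  · refine .of_forall fun x => ?_
    rw [hfin, ENNReal.mul_top]
    · exact le_top
    · simp only [ne_eq, ENNReal.coe_eq_zero, Real.toNNReal_eq_zero, not_le]; linarith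
  have hNf : N ≠ ∞ := fun h => hfin (by simp [h])
  have hGf : G ≠ ∞ := fun h => hfin (by simp [h])
  have hL2 : MemLp f 2 := by
    refine ⟨hf.aestronglyMeasurable, ?_⟩
    rw [eLpNorm_lt_top_iff_lintegral_rpow_enorm_lt_top (by norm_num) (by norm_num)]
    simpa using lt_top_iff_ne_top.2 hNf
  have hloc : LocallyIntegrable f := hL2.locallyIntegrable (by norm_num)
  -- At a Lebesgue point, f x is the limit of its averages over the balls of radius 2^{-n}, and the
  -- increments of these averages are summed.
  filter_upwards [IsUnifLocDoublingMeasure.ae_tendsto_average volume hloc 1] with x hx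
  set r : ℕ → ℝ := fun n => (1 / 2) ^ n with hr
  have hr0 : ∀ n, 0 < r n := fun n => by positivity
  set m : ℕ → E := fun n => ⨍ y in closedBall x (r n), f y with hm
  have hlim : Tendsto m atTop (𝓝 (f x)) := by
    refine hx (fun _ => x) r ?_ (.of_forall fun n => by simp [(hr0 n).le])
    rw [tendsto_nhdsWithin_iff]
    exact ⟨tendsto_pow_atTop_nhds_zero_of_lt_one (by norm_num) (by norm_num),
      .of_forall fun n => hr0 n⟩
  have hvol : ∀ n, volume (closedBall x (r n)) = ENNReal.ofReal (2 * r n) := fun n =>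
    Real.volume_closedBall x (r n)
  have hprob : ∀ n, IsProbabilityMeasure
      ((volume.restrict (closedBall x (r n)) Set.univ)⁻¹ • volume.restrict (closedBall x (r n))) := by
    intro n
    have : NeZero (volume.restrict (closedBall x (r n))) := by
      refine ⟨fun h => ?_⟩
      have := hvol n
      rw [Measure.restrict_eq_zero.1 h] at this
      have h3 := hr0 n
      rw [eq_comm, ENNReal.ofReal_eq_zero] at this
      linarith
    have : IsFiniteMeasure (volume.restrict (closedBall x (r n))) :=
      isFiniteMeasure_restrict.2 (by rw [hvol]; exact ENNReal.ofReal_ne_top)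
    infer_instance
  have hint : ∀ n, Integrable f
      ((volume.restrict (closedBall x (r n)) Set.univ)⁻¹ • volume.restrict (closedBall x (r n))) := by
    intro n
    refine Integrable.smul_measure ?_ ?_
    · exact hloc.integrableOn_isCompact (isCompact_closedBall _ _)
    · rw [Measure.restrict_apply_univ, hvol]
      simpa using hr0 n
  have havg : ∀ n c, ‖m n - c‖ₑ ^ 2 ≤
      (ENNReal.ofReal (2 * r n))⁻¹ * ∫⁻ y in closedBall x (r n), ‖f y - c‖ₑ ^ 2 := by
    intro n c
    have := hprob n
    refine (enorm_integral_sub_sq_le _ (hint n) c).trans (le_of_eq ?_)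
    rw [lintegral_smul_measure, Measure.restrict_apply_univ, hvol, smul_eq_mul]
  -- Jensen is applied to both averages. The normalising factors 1/(2 r (n+1)) and 1/(2 r n) against
  -- (2 r n)^{1+2a} leave 2^{2a} (r n)^{2a-1}.
  have hstep : ∀ n, ‖m (n + 1) - m n‖ₑ ^ 2 ≤ ENNReal.ofReal ((2 ^ a * θ ^ n) ^ 2) * G := by
    intro n
    calc ‖m (n + 1) - m n‖ₑ ^ 2
      _ ≤ (ENNReal.ofReal (2 * r (n + 1)))⁻¹ * ∫⁻ z in closedBall x (r (n + 1)), ‖f z - m n‖ₑ ^ 2 :=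
        havg _ _
      _ ≤ (ENNReal.ofReal (2 * r (n + 1)))⁻¹ * ∫⁻ z in closedBall x (r (n + 1)),
            (ENNReal.ofReal (2 * r n))⁻¹ * ∫⁻ y in closedBall x (r n), ‖f y - f z‖ₑ ^ 2 := by
        gcongr with z
        rw [← enorm_neg, neg_sub]
        exact havg _ _
      _ = (ENNReal.ofReal (2 * r (n + 1)))⁻¹ * ((ENNReal.ofReal (2 * r n))⁻¹ *
            ∫⁻ z in closedBall x (r (n + 1)), ∫⁻ y in closedBall x (r n), ‖f y - f z‖ₑ ^ 2) := by
        rw [lintegral_const_mul]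
        exact Measurable.lintegral_prod_right' (f := fun p : ℝ × ℝ => ‖f p.2 - f p.1‖ₑ ^ 2)
          (by fun_prop)
      _ ≤ (ENNReal.ofReal (2 * r (n + 1)))⁻¹ * ((ENNReal.ofReal (2 * r n))⁻¹ *
            (ENNReal.ofReal ((2 * r n) ^ (1 + 2 * a)) * G)) := by
        gcongr
        refine setLIntegral_enorm_sub_sq_le (by linarith) hf x (hr0 n)
          (closedBall_subset_closedBall ?_) measurableSet_closedBall measurableSet_closedBall
          subset_rfl
        simp only [hr, pow_succ]
        nlinarith [hr0 n, hr]
      _ = _ := by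
        rw [← ENNReal.ofReal_inv_of_pos (by have := hr0 (n+1); positivity),
          ← ENNReal.ofReal_inv_of_pos (by have := hr0 n; positivity), ← mul_assoc, ← mul_assoc,
          ← ENNReal.ofReal_mul (by have := hr0 (n+1); positivity),
          ← ENNReal.ofReal_mul (by have := hr0 (n+1); have := hr0 n; positivity)]
        congr 2
        have e1 : r (n + 1) = r n / 2 := by simp only [hr, pow_succ]; ring
        have e2 : (θ ^ n) ^ 2 = r n ^ (2 * a - 1) := by
          simp only [hr, hθ]
          rw [← Real.rpow_natCast, ← Real.rpow_natCast, ← Real.rpow_natCast,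
            ← Real.rpow_mul (by positivity), ← Real.rpow_mul (by positivity),
            ← Real.rpow_mul (by positivity)]
          congr 1; push_cast; ring
        have e3 : ((2 : ℝ) ^ a) ^ 2 = 2 * 2 ^ (2 * a - 1) := by
          rw [← Real.rpow_natCast, ← Real.rpow_mul (by norm_num),
            show a * ((2 : ℕ) : ℝ) = 1 + (2 * a - 1) by push_cast; ring,
            Real.rpow_add (by norm_num), Real.rpow_one]
        have e4 : (2 * r n) ^ (1 + 2 * a) = (2 * r n) ^ 2 * (2 ^ (2 * a - 1) * r n ^ (2 * a - 1)) := by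
          rw [← Real.mul_rpow (by norm_num) (hr0 n).le,
            show 1 + 2 * a = ((2 : ℕ) : ℝ) + (2 * a - 1) by push_cast; ring,
            Real.rpow_add (by have := hr0 n; positivity), Real.rpow_natCast]
        rw [mul_pow, e1, e2, e3, e4]
        have := (hr0 n).ne'
        field_simp
  have hdist : ∀ n, dist (m n) (m (n + 1)) ≤ 2 ^ a * √G.toReal * θ ^ n := by
    intro n
    rw [dist_comm, dist_eq_norm]
    refine le_of_sq_le_sq ?_ (by positivity)
    have h1 := ENNReal.toReal_mono (ENNReal.mul_ne_top ENNReal.ofReal_ne_top hGf) (hstep n)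
    rw [ENNReal.toReal_mul, ENNReal.toReal_ofReal (by positivity), ENNReal.toReal_pow,
      toReal_enorm] at h1
    rw [mul_pow, mul_pow, Real.sq_sqrt ENNReal.toReal_nonneg]
    linarith [mul_pow (2 ^ a) (θ ^ n) 2, h1]
  have h0 := dist_le_of_le_geometric_of_tendsto₀ θ _ hθ1 hdist hlim
  -- The first ball has length 2, so its normalising factor is at most 1.
  have hm0 : ‖m 0‖ₑ ^ 2 ≤ N := by
    have h1 := havg 0 0
    simp only [sub_zero] at h1
    refine h1.trans ?_
    calc _ ≤ 1 * N := by
          gcongr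
          · simp only [hr, pow_zero, mul_one]
            rw [ENNReal.inv_le_one]; simp
          · exact setLIntegral_le_lintegral _ _
      _ = N := one_mul _
  have hm0' : ‖m 0‖ ^ 2 ≤ N.toReal := by
    have := ENNReal.toReal_mono hNf hm0
    rwa [ENNReal.toReal_pow, toReal_enorm] at this
  have hfx : ‖f x‖ ^ 2 ≤ (2 + 2 * B ^ 2) * (N.toReal + G.toReal) := by
    have h1 : ‖f x‖ ≤ ‖m 0‖ + B * √G.toReal := by
      have : ‖f x‖ ≤ ‖m 0‖ + dist (m 0) (f x) := by
        rw [dist_comm, dist_eq_norm]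
        calc ‖f x‖ = ‖m 0 + (f x - m 0)‖ := by congr 1; abel
          _ ≤ _ := norm_add_le _ _
      refine this.trans (add_le_add le_rfl (h0.trans (le_of_eq ?_)))
      rw [hB]; ring
    have h2 := Real.sq_sqrt (ENNReal.toReal_nonneg (a := G))
    have hGn := ENNReal.toReal_nonneg (a := G)
    have hNn := ENNReal.toReal_nonneg (a := N)
    calc ‖f x‖ ^ 2 ≤ (‖m 0‖ + B * √G.toReal) ^ 2 := by gcongr
      _ ≤ 2 * ‖m 0‖ ^ 2 + 2 * (B * √G.toReal) ^ 2 := by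
          nlinarith [sq_nonneg (‖m 0‖ - B * √G.toReal)]
      _ ≤ 2 * N.toReal + 2 * (B ^ 2 * G.toReal) := by rw [mul_pow, h2]; gcongr
      _ ≤ _ := by nlinarith [mul_nonneg (sq_nonneg B) hNn, mul_nonneg (sq_nonneg B) hGn]
  have h5 : ‖f x‖ₑ ^ 2 = ENNReal.ofReal (‖f x‖ ^ 2) := by
    rw [ENNReal.ofReal_pow (norm_nonneg _), ofReal_norm]
  rw [h5]
  refine (ENNReal.ofReal_le_ofReal hfx).trans (le_of_eq ?_)
  rw [ENNReal.ofReal_mul (by linarith), ENNReal.ofReal_add ENNReal.toReal_nonneg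
    ENNReal.toReal_nonneg, ENNReal.ofReal_toReal hNf, ENNReal.ofReal_toReal hGf]
  rfl

end OneDim

end ProductSobolev

namespace ProductSobolev

/-! ### Difference norms on the plane and mixed-norm embeddings. -/

section Differences

variable {E : Type*} [NormedAddCommGroup E]

/-- The difference with step `h` in the first variable. -/
def diffFst (h : ℝ) (F : ℝ → ℝ → E) : ℝ → ℝ → E := fun x y => F (x + h) y - F x y

/-- The difference with step `k` in the second variable. -/
def diffSnd (k : ℝ) (F : ℝ → ℝ → E) : ℝ → ℝ → E := fun x y => F x (y + k) - F x y

theorem diffFst_diffSnd_comm (h k : ℝ) (F : ℝ → ℝ → E) :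
    diffFst h (diffSnd k F) = diffSnd k (diffFst h F) := by
  ext x y; simp only [diffFst, diffSnd]; abel

/-- The square of the `L²` norm on the plane. -/
noncomputable def sqNorm (F : ℝ → ℝ → E) : ℝ≥0∞ := ∫⁻ x, ∫⁻ y, ‖F x y‖ₑ ^ 2

/-- The square of the norm of `H_α^a H_β^b`, in terms of difference quotients. -/
noncomputable def diffNorm (a b : ℝ) (F : ℝ → ℝ → E) : ℝ≥0∞ :=
  sqNorm F + (∫⁻ h, sqNorm (diffFst h F) ∂(fracMeasure a)) +
    (∫⁻ k, sqNorm (diffSnd k F) ∂(fracMeasure b)) +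
    ∫⁻ h, (∫⁻ k, sqNorm (diffFst h (diffSnd k F)) ∂(fracMeasure b)) ∂(fracMeasure a)

variable [MeasurableSpace E] [BorelSpace E] [SecondCountableTopology E]

theorem measurable_diffFst {F : ℝ → ℝ → E} (hF : Measurable (Function.uncurry F)) :
    Measurable fun p : ℝ × ℝ × ℝ => diffFst p.1 F p.2.1 p.2.2 := by
  have h1 : Measurable fun p : ℝ × ℝ × ℝ => F (p.2.1 + p.1) p.2.2 :=
    hF.comp (g := Function.uncurry F) (f := fun p : ℝ × ℝ × ℝ => (p.2.1 + p.1, p.2.2))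
      (by fun_prop)
  have h2 : Measurable fun p : ℝ × ℝ × ℝ => F p.2.1 p.2.2 :=
    hF.comp (g := Function.uncurry F) (f := fun p : ℝ × ℝ × ℝ => (p.2.1, p.2.2)) (by fun_prop)
  exact h1.sub h2

theorem measurable_diffSnd {F : ℝ → ℝ → E} (hF : Measurable (Function.uncurry F)) :
    Measurable fun p : ℝ × ℝ × ℝ => diffSnd p.1 F p.2.1 p.2.2 := by
  have h1 : Measurable fun p : ℝ × ℝ × ℝ => F p.2.1 (p.2.2 + p.1) :=
    hF.comp (g := Function.uncurry F) (f := fun p : ℝ × ℝ × ℝ => (p.2.1, p.2.2 + p.1))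
      (by fun_prop)
  have h2 : Measurable fun p : ℝ × ℝ × ℝ => F p.2.1 p.2.2 :=
    hF.comp (g := Function.uncurry F) (f := fun p : ℝ × ℝ × ℝ => (p.2.1, p.2.2)) (by fun_prop)
  exact h1.sub h2

theorem measurable_diffFst_diffSnd {F : ℝ → ℝ → E} (hF : Measurable (Function.uncurry F)) :
    Measurable fun p : (ℝ × ℝ) × ℝ × ℝ => diffFst p.1.1 (diffSnd p.1.2 F) p.2.1 p.2.2 := by
  have hG := measurable_diffSnd hF
  have h1 : Measurable fun p : (ℝ × ℝ) × ℝ × ℝ => diffSnd p.1.2 F (p.2.1 + p.1.1) p.2.2 :=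
    hG.comp (f := fun p : (ℝ × ℝ) × ℝ × ℝ => (p.1.2, p.2.1 + p.1.1, p.2.2)) (by fun_prop)
  have h2 : Measurable fun p : (ℝ × ℝ) × ℝ × ℝ => diffSnd p.1.2 F p.2.1 p.2.2 :=
    hG.comp (f := fun p : (ℝ × ℝ) × ℝ × ℝ => (p.1.2, p.2.1, p.2.2)) (by fun_prop)
  exact h1.sub h2

theorem measurable_uncurry_diffFst {F : ℝ → ℝ → E} (hF : Measurable (Function.uncurry F))
    (h : ℝ) : Measurable (Function.uncurry (diffFst h F)) :=
  (measurable_diffFst hF).comp (f := fun p : ℝ × ℝ => (h, p.1, p.2)) (by fun_prop)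

theorem measurable_uncurry_diffSnd {F : ℝ → ℝ → E} (hF : Measurable (Function.uncurry F))
    (k : ℝ) : Measurable (Function.uncurry (diffSnd k F)) :=
  (measurable_diffSnd hF).comp (f := fun p : ℝ × ℝ => (k, p.1, p.2)) (by fun_prop)

theorem measurable_lintegral_lintegral {γ : Type*} [MeasurableSpace γ] {φ : γ → ℝ → ℝ → ℝ≥0∞}
    (hφ : Measurable fun p : γ × ℝ × ℝ => φ p.1 p.2.1 p.2.2) :
    Measurable fun c => ∫⁻ x, ∫⁻ y, φ c x y := by
  have h1 : Measurable fun p : γ × ℝ => ∫⁻ y, φ p.1 p.2 y :=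
    Measurable.lintegral_prod_right' (f := fun q : (γ × ℝ) × ℝ => φ q.1.1 q.1.2 q.2)
      (hφ.comp (f := fun q : (γ × ℝ) × ℝ => (q.1.1, q.1.2, q.2)) (by fun_prop))
  exact h1.lintegral_prod_right'

theorem measurable_sqNorm_diffFst {F : ℝ → ℝ → E} (hF : Measurable (Function.uncurry F)) :
    Measurable fun h => sqNorm (diffFst h F) :=
  measurable_lintegral_lintegral (φ := fun h x y => ‖diffFst h F x y‖ₑ ^ 2)
    ((measurable_diffFst hF).enorm.pow_const 2)

theorem measurable_sqNorm_diffSnd {F : ℝ → ℝ → E} (hF : Measurable (Function.uncurry F)) :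
    Measurable fun h => sqNorm (diffSnd h F) :=
  measurable_lintegral_lintegral (φ := fun h x y => ‖diffSnd h F x y‖ₑ ^ 2)
    ((measurable_diffSnd hF).enorm.pow_const 2)

theorem measurable_sqNorm_diffFst_diffSnd {F : ℝ → ℝ → E}
    (hF : Measurable (Function.uncurry F)) :
    Measurable fun p : ℝ × ℝ => sqNorm (diffFst p.1 (diffSnd p.2 F)) :=
  measurable_lintegral_lintegral
    (φ := fun (p : ℝ × ℝ) x y => ‖diffFst p.1 (diffSnd p.2 F) x y‖ₑ ^ 2)
    ((measurable_diffFst_diffSnd hF).enorm.pow_const 2)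

theorem lintegral_diffFst_diffSnd_swap (a b : ℝ) {F : ℝ → ℝ → E}
    (hF : Measurable (Function.uncurry F)) :
    ∫⁻ h, (∫⁻ k, sqNorm (diffFst h (diffSnd k F)) ∂(fracMeasure b)) ∂(fracMeasure a) =
      ∫⁻ k, (∫⁻ h, sqNorm (diffFst h (diffSnd k F)) ∂(fracMeasure a)) ∂(fracMeasure b) :=
  lintegral_lintegral_swap (f := fun h k => sqNorm (diffFst h (diffSnd k F)))
    (measurable_sqNorm_diffFst_diffSnd hF).aemeasurable

/-- A weighted Sobolev embedding in the first variable. -/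
theorem exists_lintegral_fst_weight_le (E : Type*) [NormedAddCommGroup E] [MeasurableSpace E]
    [BorelSpace E] [SecondCountableTopology E] [NormedSpace ℝ E] [CompleteSpace E]
    {a : ℝ} (ha : 1 / 2 < a) : ∃ K : ℝ≥0, ∀ F : ℝ → ℝ → E,
    Measurable (Function.uncurry F) → ∀ n : ℝ → ℝ≥0∞, Measurable n →
      ∫⁻ x, ∫⁻ y, n x * ‖F x y‖ₑ ^ 2 ≤
        K * (∫⁻ x, n x) * (sqNorm F + ∫⁻ h, sqNorm (diffFst h F) ∂(fracMeasure a)) := by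
  obtain ⟨K, hK⟩ := exists_ae_enorm_sq_le (E := E) ha
  refine ⟨K, fun F hF n hn => ?_⟩
  have hFm : Measurable fun p : ℝ × ℝ => ‖F p.1 p.2‖ₑ ^ 2 := hF.enorm.pow_const 2
  have hFm' : Measurable fun p : ℝ × ℝ => ‖F p.2 p.1‖ₑ ^ 2 := hFm.comp measurable_swap
  have hD : Measurable fun p : ℝ × ℝ × ℝ => ‖diffFst p.1 F p.2.1 p.2.2‖ₑ ^ 2 :=
    (measurable_diffFst hF).enorm.pow_const 2
  have hnF : Measurable fun p : ℝ × ℝ => n p.1 * ‖F p.1 p.2‖ₑ ^ 2 :=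
    (hn.comp measurable_fst).mul hFm
  rw [lintegral_lintegral_swap (f := fun x y => n x * ‖F x y‖ₑ ^ 2) hnF.aemeasurable]
  set S : ℝ → ℝ≥0∞ := fun y => (∫⁻ x, ‖F x y‖ₑ ^ 2) +
    ∫⁻ h, (∫⁻ x, ‖diffFst h F x y‖ₑ ^ 2) ∂(fracMeasure a) with hS
  -- For fixed y the one-dimensional embedding bounds ‖F x y‖² by K · S y for almost every x, so
  -- that the weight integrates separately.
  have hy : ∀ y, ∫⁻ x, n x * ‖F x y‖ₑ ^ 2 ≤ K * (∫⁻ x, n x) * S y := by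
    intro y
    calc _ ≤ ∫⁻ x, n x * (K * S y) := by
          refine lintegral_mono_ae ?_
          filter_upwards [hK (fun x => F x y)
            (hF.comp (g := Function.uncurry F) (f := fun x => (x, y)) (by fun_prop))] with x hx
          gcongr
          exact hx
      _ = _ := by rw [lintegral_mul_const _ hn]; ring
  have m1 : Measurable fun y => ∫⁻ x, ‖F x y‖ₑ ^ 2 := hFm'.lintegral_prod_right'
  have m2 : Measurable fun p : ℝ × ℝ => ∫⁻ x, ‖diffFst p.2 F x p.1‖ₑ ^ 2 :=
    Measurable.lintegral_prod_right' (f := fun q : (ℝ × ℝ) × ℝ => ‖diffFst q.1.2 F q.2 q.1.1‖ₑ ^ 2)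
      (hD.comp (f := fun q : (ℝ × ℝ) × ℝ => (q.1.2, q.2, q.1.1)) (by fun_prop))
  have m3 : Measurable fun y => ∫⁻ h, (∫⁻ x, ‖diffFst h F x y‖ₑ ^ 2) ∂(fracMeasure a) :=
    m2.lintegral_prod_right'
  calc _ ≤ ∫⁻ y, K * (∫⁻ x, n x) * S y := lintegral_mono hy
    _ = K * (∫⁻ x, n x) * ∫⁻ y, S y := lintegral_const_mul _ (m1.add m3)
    _ = _ := by
      congr 1
      rw [hS, lintegral_add_left m1]
      congr 1
      · exact lintegral_lintegral_swap (f := fun y x => ‖F x y‖ₑ ^ 2) hFm'.aemeasurable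
      · rw [lintegral_lintegral_swap (f := fun y h => ∫⁻ x, ‖diffFst h F x y‖ₑ ^ 2)
          m2.aemeasurable]
        refine lintegral_congr fun h => ?_
        exact lintegral_lintegral_swap (f := fun y x => ‖diffFst h F x y‖ₑ ^ 2)
          (hD.comp (f := fun q : ℝ × ℝ => (h, q.2, q.1)) (by fun_prop)).aemeasurable

/-- The square of the `L^2_α H^b_β`-norm along a line parallel to the second axis. -/
noncomputable def sliceNorm (b : ℝ) (F : ℝ → ℝ → E) (x : ℝ) : ℝ≥0∞ :=
  (∫⁻ y, ‖F x y‖ₑ ^ 2) + ∫⁻ k, (∫⁻ y, ‖diffSnd k F x y‖ₑ ^ 2) ∂(fracMeasure b)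

theorem measurable_lintegral_diffSnd {F : ℝ → ℝ → E} (hF : Measurable (Function.uncurry F)) :
    Measurable fun p : ℝ × ℝ => ∫⁻ y, ‖diffSnd p.2 F p.1 y‖ₑ ^ 2 :=
  Measurable.lintegral_prod_right' (f := fun q : (ℝ × ℝ) × ℝ => ‖diffSnd q.1.2 F q.1.1 q.2‖ₑ ^ 2)
    (((measurable_diffSnd hF).enorm.pow_const 2).comp
      (f := fun q : (ℝ × ℝ) × ℝ => (q.1.2, q.1.1, q.2)) (by fun_prop))

omit [SecondCountableTopology E] in
theorem measurable_lintegral_snd {F : ℝ → ℝ → E} (hF : Measurable (Function.uncurry F)) :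
    Measurable fun x => ∫⁻ y, ‖F x y‖ₑ ^ 2 :=
  Measurable.lintegral_prod_right' (f := fun p : ℝ × ℝ => ‖F p.1 p.2‖ₑ ^ 2) (hF.enorm.pow_const 2)

theorem measurable_sliceNorm (b : ℝ) {F : ℝ → ℝ → E} (hF : Measurable (Function.uncurry F)) :
    Measurable (sliceNorm b F) :=
  (measurable_lintegral_snd hF).add (measurable_lintegral_diffSnd hF).lintegral_prod_right'

theorem lintegral_sliceNorm (b : ℝ) {F : ℝ → ℝ → E} (hF : Measurable (Function.uncurry F)) :
    ∫⁻ x, sliceNorm b F x = sqNorm F + ∫⁻ k, sqNorm (diffSnd k F) ∂(fracMeasure b) := by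
  simp only [sliceNorm]
  rw [lintegral_add_left (measurable_lintegral_snd hF)]
  congr 1
  exact lintegral_lintegral_swap (f := fun x k => ∫⁻ y, ‖diffSnd k F x y‖ₑ ^ 2)
    (measurable_lintegral_diffSnd hF).aemeasurable

omit [NormedAddCommGroup E] [BorelSpace E] [SecondCountableTopology E] in
theorem measurable_snd_slice {F : ℝ → ℝ → E} (hF : Measurable (Function.uncurry F)) (x : ℝ) :
    Measurable (F x) :=
  hF.comp (g := Function.uncurry F) (f := fun y => (x, y)) (by fun_prop)

/-- The mixed-norm product estimate: the product of a function in `L^2_α L^∞_β` with a function in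
`L^∞_α L^2_β` is in `L²`. -/
theorem exists_lintegral_mul_le (E : Type*) [NormedAddCommGroup E] [MeasurableSpace E]
    [BorelSpace E] [SecondCountableTopology E] [NormedSpace ℝ E] [CompleteSpace E]
    {a b : ℝ} (ha : 1 / 2 < a) (hb : 1 / 2 < b) :
    ∃ K : ℝ≥0, ∀ A B : ℝ → ℝ → E, Measurable (Function.uncurry A) →
      Measurable (Function.uncurry B) →
      ∫⁻ x, ∫⁻ y, ‖A x y‖ₑ ^ 2 * ‖B x y‖ₑ ^ 2 ≤
        K * (sqNorm A + ∫⁻ k, sqNorm (diffSnd k A) ∂(fracMeasure b)) *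
          (sqNorm B + ∫⁻ h, sqNorm (diffFst h B) ∂(fracMeasure a)) := by
  obtain ⟨K₁, hK₁⟩ := exists_lintegral_fst_weight_le E ha
  obtain ⟨K₂, hK₂⟩ := exists_ae_enorm_sq_le (E := E) hb
  refine ⟨K₁ * K₂, fun A B hA hB => ?_⟩
  -- The embedding in y replaces ‖A x y‖² by a function of x alone, which then serves as the weight
  -- in the embedding of B in x.
  have hx : ∀ x, ∫⁻ y, ‖A x y‖ₑ ^ 2 * ‖B x y‖ₑ ^ 2 ≤
      ∫⁻ y, (K₂ * sliceNorm b A x) * ‖B x y‖ₑ ^ 2 := by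
    intro x
    refine lintegral_mono_ae ?_
    filter_upwards [hK₂ (A x) (measurable_snd_slice hA x)] with y hy
    gcongr
    exact hy
  calc _ ≤ ∫⁻ x, ∫⁻ y, (K₂ * sliceNorm b A x) * ‖B x y‖ₑ ^ 2 := lintegral_mono hx
    _ ≤ K₁ * (∫⁻ x, K₂ * sliceNorm b A x) *
        (sqNorm B + ∫⁻ h, sqNorm (diffFst h B) ∂(fracMeasure a)) :=
      hK₁ B hB _ ((measurable_sliceNorm b hA).const_mul _)
    _ = _ := by
      rw [lintegral_const_mul _ (measurable_sliceNorm b hA), lintegral_sliceNorm b hA,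
        ENNReal.coe_mul]
      ring

/-- The central estimate. For fixed h and k the mixed-norm product bound has the form K · P h · R k,
so the double integral factorises; the embeddings cost one more difference in the other variable,
which is why the mixed term belongs to `diffNorm`. -/
theorem exists_lintegral_diffFst_mul_diffSnd_le (E : Type*) [NormedAddCommGroup E]
    [MeasurableSpace E] [BorelSpace E] [SecondCountableTopology E] [NormedSpace ℝ E]
    [CompleteSpace E] {a b : ℝ} (ha : 1 / 2 < a) (hb : 1 / 2 < b) :
    ∃ K : ℝ≥0, ∀ F G : ℝ → ℝ → E, Measurable (Function.uncurry F) →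
      Measurable (Function.uncurry G) →
      ∫⁻ h, (∫⁻ k, (∫⁻ x, ∫⁻ y, ‖diffFst h F x y‖ₑ ^ 2 * ‖diffSnd k G x y‖ₑ ^ 2)
        ∂(fracMeasure b)) ∂(fracMeasure a) ≤ K * diffNorm a b F * diffNorm a b G := by
  obtain ⟨K, hK⟩ := exists_lintegral_mul_le E ha hb
  refine ⟨K, fun F G hF hG => ?_⟩
  have mF : Measurable fun h => ∫⁻ k, sqNorm (diffFst h (diffSnd k F)) ∂(fracMeasure b) :=
    (measurable_sqNorm_diffFst_diffSnd hF).lintegral_prod_right'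
  have mG : Measurable fun k => ∫⁻ h, sqNorm (diffFst h (diffSnd k G)) ∂(fracMeasure a) :=
    ((measurable_sqNorm_diffFst_diffSnd hG).comp measurable_swap).lintegral_prod_right'
  set P : ℝ → ℝ≥0∞ := fun h => sqNorm (diffFst h F) +
    ∫⁻ k, sqNorm (diffFst h (diffSnd k F)) ∂(fracMeasure b)
  set R : ℝ → ℝ≥0∞ := fun k => sqNorm (diffSnd k G) +
    ∫⁻ h, sqNorm (diffFst h (diffSnd k G)) ∂(fracMeasure a)
  have mP : Measurable P := (measurable_sqNorm_diffFst hF).add mF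
  have mR : Measurable R := (measurable_sqNorm_diffSnd hG).add mG
  calc _ ≤ ∫⁻ h, (∫⁻ k, (K * P h) * R k ∂(fracMeasure b)) ∂(fracMeasure a) := by
        refine lintegral_mono fun h => lintegral_mono fun k => ?_
        have := hK (diffFst h F) (diffSnd k G) (measurable_uncurry_diffFst hF h)
          (measurable_uncurry_diffSnd hG k)
        rw [← funext fun k => congrArg sqNorm (diffFst_diffSnd_comm h k F)] at this
        exact this
    _ = K * (∫⁻ h, P h ∂(fracMeasure a)) * ∫⁻ k, R k ∂(fracMeasure b) := by
        simp_rw [lintegral_const_mul _ mR]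
        rw [lintegral_mul_const _ (mP.const_mul _), lintegral_const_mul _ mP]
    _ ≤ _ := by
        -- The integrals of P and of R are each two of the four summands of a `diffNorm`.
        rw [lintegral_add_left (measurable_sqNorm_diffFst hF),
          lintegral_add_left (measurable_sqNorm_diffSnd hG), ← lintegral_diffFst_diffSnd_swap a b hG]
        gcongr
        · exact le_add_self.trans_eq (b := (sqNorm F + ∫⁻ k, sqNorm (diffSnd k F)
            ∂(fracMeasure b)) + _) (by rw [diffNorm]; ring)
        · exact le_add_self.trans_eq (b := (sqNorm G + ∫⁻ h, sqNorm (diffFst h G)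
            ∂(fracMeasure a)) + _) (by rw [diffNorm]; ring)

/-- The Sobolev embedding `H_α^a H_β^b ⊆ L^∞`, `a, b > 1/2`. -/
theorem exists_ae_ae_enorm_sq_le (E : Type*) [NormedAddCommGroup E] [MeasurableSpace E]
    [BorelSpace E] [SecondCountableTopology E] [NormedSpace ℝ E] [CompleteSpace E]
    {a b : ℝ} (ha : 1 / 2 < a) (hb : 1 / 2 < b) :
    ∃ K : ℝ≥0, ∀ F : ℝ → ℝ → E, Measurable (Function.uncurry F) →
      ∀ᵐ x, ∀ᵐ y, ‖F x y‖ₑ ^ 2 ≤ K * diffNorm a b F := by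
  obtain ⟨K₁, hK₁⟩ := exists_lintegral_fst_weight_le E ha
  obtain ⟨K₂, hK₂⟩ := exists_ae_enorm_sq_le (E := E) hb
  refine ⟨K₂ * K₁, fun F hF => ?_⟩
  -- The weighted embedding in x is applied to F and to every difference in y, then integrated over
  -- the steps k.
  have hw : ∀ n : ℝ → ℝ≥0∞, Measurable n →
      ∫⁻ x, n x * sliceNorm b F x ≤ K₁ * (∫⁻ x, n x) * diffNorm a b F := by
    intro n hn
    have e : ∀ x, n x * sliceNorm b F x = (∫⁻ y, n x * ‖F x y‖ₑ ^ 2) +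
        ∫⁻ k, (∫⁻ y, n x * ‖diffSnd k F x y‖ₑ ^ 2) ∂(fracMeasure b) := by
      intro x
      rw [sliceNorm, mul_add, lintegral_const_mul _
        ((measurable_snd_slice hF x).enorm.pow_const 2)]
      congr 1
      have m : Measurable fun k => ∫⁻ y, ‖diffSnd k F x y‖ₑ ^ 2 :=
        (measurable_lintegral_diffSnd hF).comp (f := fun k : ℝ => (x, k)) (by fun_prop)
      rw [← lintegral_const_mul _ m]
      refine lintegral_congr fun k => ?_
      rw [lintegral_const_mul _ ((measurable_snd_slice
        (measurable_uncurry_diffSnd hF k) x).enorm.pow_const 2)]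
    have mD : Measurable fun p : ℝ × ℝ => ∫⁻ y, n p.1 * ‖diffSnd p.2 F p.1 y‖ₑ ^ 2 := by
      refine Measurable.lintegral_prod_right'
        (f := fun q : (ℝ × ℝ) × ℝ => n q.1.1 * ‖diffSnd q.1.2 F q.1.1 q.2‖ₑ ^ 2) ?_
      exact (hn.comp (measurable_fst.comp measurable_fst)).mul
        (((measurable_diffSnd hF).enorm.pow_const 2).comp
          (f := fun q : (ℝ × ℝ) × ℝ => (q.1.2, q.1.1, q.2)) (by fun_prop))
    have mN : Measurable fun x => ∫⁻ y, n x * ‖F x y‖ₑ ^ 2 :=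
      Measurable.lintegral_prod_right' (f := fun p : ℝ × ℝ => n p.1 * ‖F p.1 p.2‖ₑ ^ 2)
        ((hn.comp measurable_fst).mul (hF.enorm.pow_const 2))
    have mG : Measurable fun k => ∫⁻ h, sqNorm (diffFst h (diffSnd k F)) ∂(fracMeasure a) :=
      ((measurable_sqNorm_diffFst_diffSnd hF).comp measurable_swap).lintegral_prod_right'
    simp_rw [e]
    rw [lintegral_add_left mN, lintegral_lintegral_swap
      (f := fun x k => ∫⁻ y, n x * ‖diffSnd k F x y‖ₑ ^ 2) mD.aemeasurable]
    calc _ ≤ K₁ * (∫⁻ x, n x) * (sqNorm F + ∫⁻ h, sqNorm (diffFst h F) ∂(fracMeasure a)) +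
          ∫⁻ k, K₁ * (∫⁻ x, n x) * (sqNorm (diffSnd k F) +
            ∫⁻ h, sqNorm (diffFst h (diffSnd k F)) ∂(fracMeasure a)) ∂(fracMeasure b) :=
          add_le_add (hK₁ F hF n hn) (lintegral_mono fun k =>
            hK₁ _ (measurable_uncurry_diffSnd hF k) n hn)
      _ = _ := by
          have m : Measurable fun k => sqNorm (diffSnd k F) +
              ∫⁻ h, sqNorm (diffFst h (diffSnd k F)) ∂(fracMeasure a) :=
            (measurable_sqNorm_diffSnd hF).add mG
          rw [lintegral_const_mul _ m, lintegral_add_left (measurable_sqNorm_diffSnd hF), ← mul_add,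
            ← lintegral_diffFst_diffSnd_swap a b hF, diffNorm]
          simp only [add_assoc]
  -- Indicator weights turn the weighted bound into an almost everywhere bound on the slices; the
  -- embedding in y then acts on each slice.
  have hs : sliceNorm b F ≤ᵐ[volume] fun _ => K₁ * diffNorm a b F := by
    refine ae_le_of_forall_setLIntegral_le_of_sigmaFinite (measurable_sliceNorm b hF)
      fun s hs _ => ?_
    have := hw (s.indicator 1) (measurable_one.indicator hs)
    rw [lintegral_indicator_one hs] at this
    rw [← lintegral_indicator hs, setLIntegral_const]
    calc _ = ∫⁻ x, s.indicator 1 x * sliceNorm b F x := by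
          refine lintegral_congr fun x => ?_
          by_cases hx : x ∈ s <;> simp [hx]
      _ ≤ _ := this
      _ = _ := by ring
  filter_upwards [hs] with x hx
  filter_upwards [hK₂ (F x) (measurable_snd_slice hF x)] with y hy
  rw [ENNReal.coe_mul, mul_assoc]
  refine hy.trans ?_
  gcongr
  exact hx

end Differences

/-! ### Pointwise inequalities for first and mixed differences of compositions. -/

section Pointwise

variable {V W : Type*} [NormedAddCommGroup V] [NormedSpace ℝ V]
  [NormedAddCommGroup W] [NormedSpace ℝ W]

theorem norm_sub_le_of_fderiv {g : V → W} {M : ℝ} (hg : Differentiable ℝ g)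
    (h : ∀ x, ‖fderiv ℝ g x‖ ≤ M) (x y : V) : ‖g y - g x‖ ≤ M * ‖y - x‖ :=
  Convex.norm_image_sub_le_of_norm_fderiv_le (s := Set.univ) (fun z _ => hg z) (fun z _ => h z)
    convex_univ trivial trivial

/-- The point b + (c - a) completes the parallelogram. It differs from d by the mixed difference,
which costs one derivative; on an exact parallelogram, z ↦ g (z + (c - a)) - g z has derivative at
most M‖c - a‖ and is compared at a and b. -/
theorem norm_four_point_le {g : V → W} {M : ℝ} (hg : Differentiable ℝ g)
    (hg' : Differentiable ℝ (fderiv ℝ g)) (h1 : ∀ x, ‖fderiv ℝ g x‖ ≤ M)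
    (h2 : ∀ x, ‖fderiv ℝ (fderiv ℝ g) x‖ ≤ M) (a b c d : V) :
    ‖g d - g b - g c + g a‖ ≤ M * ‖d - b - c + a‖ + M * ‖b - a‖ * ‖c - a‖ := by
  have e1 : ‖g d - g (b + (c - a))‖ ≤ M * ‖d - b - c + a‖ := by
    have := norm_sub_le_of_fderiv hg h1 (b + (c - a)) d
    rwa [show d - (b + (c - a)) = d - b - c + a by abel] at this
  have e2 : ‖(g (b + (c - a)) - g b) - (g (a + (c - a)) - g a)‖ ≤ M * ‖c - a‖ * ‖b - a‖ := by
    have hφ : ∀ z, HasFDerivAt (fun z => g (z + (c - a)) - g z)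
        (fderiv ℝ g (z + (c - a)) - fderiv ℝ g z) z := fun z =>
      ((hasFDerivAt_comp_add_right (c - a)).2 (hg _).hasFDerivAt).sub (hg z).hasFDerivAt
    refine norm_sub_le_of_fderiv (g := fun z => g (z + (c - a)) - g z)
      (fun z => (hφ z).differentiableAt) (fun z => ?_) a b
    rw [(hφ z).fderiv]
    simpa using norm_sub_le_of_fderiv hg' h2 z (z + (c - a))
  rw [add_sub_cancel a c] at e2
  calc ‖g d - g b - g c + g a‖
      = ‖(g d - g (b + (c - a))) + ((g (b + (c - a)) - g b) - (g c - g a))‖ := by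
        congr 1; abel
    _ ≤ _ := (norm_add_le _ _).trans (add_le_add e1 (e2.trans (le_of_eq (by ring))))

theorem hasDerivAt_comp_segment {g : V → W} (hg : Differentiable ℝ g) (p q : V) (t : ℝ) :
    HasDerivAt (fun t : ℝ => g (q + t • (p - q))) (fderiv ℝ g (q + t • (p - q)) (p - q)) t := by
  have h1 : HasDerivAt (fun t : ℝ => q + t • (p - q)) (p - q) t := by
    simpa using ((hasDerivAt_id t).smul_const (p - q)).const_add q
  exact (hg _).hasFDerivAt.comp_hasDerivAt t h1

theorem norm_segment_le (x y : V) {t : ℝ} (ht : t ∈ Set.Icc (0 : ℝ) 1) :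
    ‖y + t • (x - y)‖ ≤ ‖x‖ + ‖y‖ := by
  have : y + t • (x - y) = t • x + (1 - t) • y := by module
  rw [this]
  refine (norm_add_le _ _).trans ?_
  rw [norm_smul, norm_smul, Real.norm_of_nonneg ht.1, Real.norm_of_nonneg (by linarith [ht.2])]
  have := norm_nonneg x
  have := norm_nonneg y
  nlinarith [ht.1, ht.2]

theorem norm_sub_le_of_hasDerivAt_segment {φ φ' : ℝ → W} {B : ℝ}
    (h : ∀ t, HasDerivAt φ (φ' t) t) (hB : ∀ t ∈ Set.Icc (0 : ℝ) 1, ‖φ' t‖ ≤ B) :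
    ‖φ 1 - φ 0‖ ≤ B :=
  norm_image_sub_le_of_norm_deriv_le_segment_01' (fun t _ => (h t).hasDerivWithinAt)
    fun t ht => hB t ⟨ht.1, ht.2.le⟩

/-- Differentiation along the segments from the points with index 2 to those with index 1. The
product rule for differences splits the derivative into a part where the difference falls on the
direction and a part where it falls on the derivative of g; only the latter sees the size Ω of the
direction. -/
theorem norm_diff_two_point_le {g : V → W} {M Ω : ℝ} (hM : 0 ≤ M) (hg : Differentiable ℝ g)
    (hg' : Differentiable ℝ (fderiv ℝ g)) (h1 : ∀ x, ‖fderiv ℝ g x‖ ≤ M)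
    (h2 : ∀ x, ‖fderiv ℝ (fderiv ℝ g) x‖ ≤ M) (a₁ b₁ a₂ b₂ : V) (ha : ‖a₁ - a₂‖ ≤ Ω) :
    ‖(g b₁ - g b₂) - (g a₁ - g a₂)‖ ≤
      M * ‖(b₁ - b₂) - (a₁ - a₂)‖ + M * Ω * (‖b₁ - a₁‖ + ‖b₂ - a₂‖) := by
  set L := fun (p q : V) (t : ℝ) => q + t • (p - q) with hL
  have hd : ∀ t, HasDerivAt (fun t => g (L b₁ b₂ t) - g (L a₁ a₂ t))
      (fderiv ℝ g (L b₁ b₂ t) (b₁ - b₂) - fderiv ℝ g (L a₁ a₂ t) (a₁ - a₂)) t := fun t =>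
    (hasDerivAt_comp_segment hg b₁ b₂ t).sub (hasDerivAt_comp_segment hg a₁ a₂ t)
  have hb : ∀ t ∈ Set.Icc (0 : ℝ) 1,
      ‖fderiv ℝ g (L b₁ b₂ t) (b₁ - b₂) - fderiv ℝ g (L a₁ a₂ t) (a₁ - a₂)‖ ≤
      M * ‖(b₁ - b₂) - (a₁ - a₂)‖ + M * Ω * (‖b₁ - a₁‖ + ‖b₂ - a₂‖) := by
    intro t ht
    have e : fderiv ℝ g (L b₁ b₂ t) (b₁ - b₂) - fderiv ℝ g (L a₁ a₂ t) (a₁ - a₂) =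
        fderiv ℝ g (L b₁ b₂ t) ((b₁ - b₂) - (a₁ - a₂)) +
          (fderiv ℝ g (L b₁ b₂ t) - fderiv ℝ g (L a₁ a₂ t)) (a₁ - a₂) := by
      simp only [map_sub, _root_.sub_apply]; abel
    rw [e]
    refine (norm_add_le _ _).trans (add_le_add ?_ ?_)
    · exact ContinuousLinearMap.le_of_opNorm_le _ (h1 _) _
    · have e1 : ‖L b₁ b₂ t - L a₁ a₂ t‖ ≤ ‖b₁ - a₁‖ + ‖b₂ - a₂‖ := by
        have := norm_segment_le (b₁ - a₁) (b₂ - a₂) ht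
        rwa [show b₂ - a₂ + t • (b₁ - a₁ - (b₂ - a₂)) = L b₁ b₂ t - L a₁ a₂ t by
          simp only [hL]; module] at this
      calc _ ≤ (M * ‖L b₁ b₂ t - L a₁ a₂ t‖) * ‖a₁ - a₂‖ :=
            ContinuousLinearMap.le_of_opNorm_le _ (norm_sub_le_of_fderiv hg' h2 _ _) _
        _ ≤ (M * (‖b₁ - a₁‖ + ‖b₂ - a₂‖)) * Ω := by gcongr
        _ = _ := by ring
  have := norm_sub_le_of_hasDerivAt_segment hd hb
  simp only [hL, one_smul, zero_smul, add_zero, add_sub_cancel] at this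
  rwa [show g b₁ - g b₂ - (g a₁ - g a₂) = g b₁ - g a₁ - (g b₂ - g a₂) by abel]

-- The second-order analogue of `norm_diff_two_point_le`. The mixed difference of the pairing of g'
-- with the direction is expanded by the product rule, and `norm_four_point_le` is applied to g',
-- which is where the third derivative enters.
set_option maxSynthPendingDepth 10 in
theorem norm_diff_four_point_le {g : V → W} {M Ω : ℝ} (hM : 0 ≤ M) (hg : Differentiable ℝ g)
    (hg' : Differentiable ℝ (fderiv ℝ g)) (hg'' : Differentiable ℝ (fderiv ℝ (fderiv ℝ g)))
    (h1 : ∀ x, ‖fderiv ℝ g x‖ ≤ M) (h2 : ∀ x, ‖fderiv ℝ (fderiv ℝ g) x‖ ≤ M)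
    (h3 : ∀ x, ‖fderiv ℝ (fderiv ℝ (fderiv ℝ g)) x‖ ≤ M)
    (a₁ b₁ c₁ d₁ a₂ b₂ c₂ d₂ : V) (ha : ‖a₁ - a₂‖ ≤ Ω) (hb : ‖b₁ - b₂‖ ≤ Ω)
    (hc : ‖c₁ - c₂‖ ≤ Ω) :
    ‖(g d₁ - g b₁ - g c₁ + g a₁) - (g d₂ - g b₂ - g c₂ + g a₂)‖ ≤
      M * (‖(d₁ - b₁ - c₁ + a₁) - (d₂ - b₂ - c₂ + a₂)‖ +
        (‖c₁ - a₁‖ + ‖c₂ - a₂‖) * ‖(b₁ - a₁) - (b₂ - a₂)‖ +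
        (‖b₁ - a₁‖ + ‖b₂ - a₂‖) * ‖(c₁ - a₁) - (c₂ - a₂)‖ +
        5 * Ω * (‖d₁ - b₁ - c₁ + a₁‖ + ‖d₂ - b₂ - c₂ + a₂‖) +
        Ω * (‖b₁ - a₁‖ + ‖b₂ - a₂‖) * (‖c₁ - a₁‖ + ‖c₂ - a₂‖)) := by
  set L := fun (p q : V) (t : ℝ) => q + t • (p - q) with hL
  set p := ‖b₁ - a₁‖ + ‖b₂ - a₂‖ with hp
  set q := ‖c₁ - a₁‖ + ‖c₂ - a₂‖ with hq
  set r := ‖d₁ - b₁ - c₁ + a₁‖ + ‖d₂ - b₂ - c₂ + a₂‖ with hr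
  have hp0 : 0 ≤ p := by positivity
  have hq0 : 0 ≤ q := by positivity
  have hr0 : 0 ≤ r := by positivity
  have hΩ : 0 ≤ Ω := (norm_nonneg _).trans ha
  set φ' : ℝ → W := fun t => fderiv ℝ g (L d₁ d₂ t) (d₁ - d₂) - fderiv ℝ g (L b₁ b₂ t) (b₁ - b₂) -
    fderiv ℝ g (L c₁ c₂ t) (c₁ - c₂) + fderiv ℝ g (L a₁ a₂ t) (a₁ - a₂) with hφ'
  have hd : ∀ t, HasDerivAt
      (fun t => g (L d₁ d₂ t) - g (L b₁ b₂ t) - g (L c₁ c₂ t) + g (L a₁ a₂ t)) (φ' t) t := fun t =>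
    (((hasDerivAt_comp_segment hg d₁ d₂ t).sub (hasDerivAt_comp_segment hg b₁ b₂ t)).sub
      (hasDerivAt_comp_segment hg c₁ c₂ t)).add (hasDerivAt_comp_segment hg a₁ a₂ t)
  have hbd : ∀ t ∈ Set.Icc (0 : ℝ) 1, ‖φ' t‖ ≤
      M * (‖(d₁ - b₁ - c₁ + a₁) - (d₂ - b₂ - c₂ + a₂)‖ + q * ‖(b₁ - a₁) - (b₂ - a₂)‖ +
        p * ‖(c₁ - a₁) - (c₂ - a₂)‖ + 5 * Ω * r + Ω * p * q) := by
    intro t ht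
    have ep : ‖L b₁ b₂ t - L a₁ a₂ t‖ ≤ p := by
      have := norm_segment_le (b₁ - a₁) (b₂ - a₂) ht
      rwa [show b₂ - a₂ + t • (b₁ - a₁ - (b₂ - a₂)) = L b₁ b₂ t - L a₁ a₂ t by
        simp only [hL]; module] at this
    have eq : ‖L c₁ c₂ t - L a₁ a₂ t‖ ≤ q := by
      have := norm_segment_le (c₁ - a₁) (c₂ - a₂) ht
      rwa [show c₂ - a₂ + t • (c₁ - a₁ - (c₂ - a₂)) = L c₁ c₂ t - L a₁ a₂ t by
        simp only [hL]; module] at this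
    have er : ‖L d₁ d₂ t - L b₁ b₂ t - L c₁ c₂ t + L a₁ a₂ t‖ ≤ r := by
      have := norm_segment_le (d₁ - b₁ - c₁ + a₁) (d₂ - b₂ - c₂ + a₂) ht
      rwa [show d₂ - b₂ - c₂ + a₂ + t • (d₁ - b₁ - c₁ + a₁ - (d₂ - b₂ - c₂ + a₂)) =
        L d₁ d₂ t - L b₁ b₂ t - L c₁ c₂ t + L a₁ a₂ t by simp only [hL]; module] at this
    -- The side d - b differs from c - a by the mixed difference. The excess r is paired with a
    -- direction increment of size at most 2Ω, here and for d - c; with one more Ω r from the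
    -- four-point bound this makes 5 Ω r.
    have edb : ‖L d₁ d₂ t - L b₁ b₂ t‖ ≤ q + r := by
      rw [show L d₁ d₂ t - L b₁ b₂ t = (L c₁ c₂ t - L a₁ a₂ t) +
        (L d₁ d₂ t - L b₁ b₂ t - L c₁ c₂ t + L a₁ a₂ t) by abel]
      exact (norm_add_le _ _).trans (add_le_add eq er)
    have edc : ‖L d₁ d₂ t - L c₁ c₂ t‖ ≤ p + r := by
      rw [show L d₁ d₂ t - L c₁ c₂ t = (L b₁ b₂ t - L a₁ a₂ t) +
        (L d₁ d₂ t - L b₁ b₂ t - L c₁ c₂ t + L a₁ a₂ t) by abel]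
      exact (norm_add_le _ _).trans (add_le_add ep er)
    have ewb : ‖(b₁ - a₁) - (b₂ - a₂)‖ ≤ 2 * Ω := by
      rw [show (b₁ - a₁) - (b₂ - a₂) = (b₁ - b₂) - (a₁ - a₂) by abel]
      exact (norm_sub_le _ _).trans (by linarith)
    have ewc : ‖(c₁ - a₁) - (c₂ - a₂)‖ ≤ 2 * Ω := by
      rw [show (c₁ - a₁) - (c₂ - a₂) = (c₁ - c₂) - (a₁ - a₂) by abel]
      exact (norm_sub_le _ _).trans (by linarith)
    -- Product rule for mixed differences, arranged so that the undifferenced direction occurs only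
    -- at a.
    have e : φ' t = fderiv ℝ g (L d₁ d₂ t) ((d₁ - b₁ - c₁ + a₁) - (d₂ - b₂ - c₂ + a₂)) +
        (fderiv ℝ g (L d₁ d₂ t) - fderiv ℝ g (L b₁ b₂ t)) ((b₁ - a₁) - (b₂ - a₂)) +
        (fderiv ℝ g (L d₁ d₂ t) - fderiv ℝ g (L c₁ c₂ t)) ((c₁ - a₁) - (c₂ - a₂)) +
        (fderiv ℝ g (L d₁ d₂ t) - fderiv ℝ g (L b₁ b₂ t) - fderiv ℝ g (L c₁ c₂ t) +
          fderiv ℝ g (L a₁ a₂ t)) (a₁ - a₂) := by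
      simp only [hφ', map_sub, map_add, _root_.sub_apply,
        _root_.add_apply]
      abel
    have t1 : ‖fderiv ℝ g (L d₁ d₂ t) ((d₁ - b₁ - c₁ + a₁) - (d₂ - b₂ - c₂ + a₂))‖ ≤
        M * ‖(d₁ - b₁ - c₁ + a₁) - (d₂ - b₂ - c₂ + a₂)‖ :=
      ContinuousLinearMap.le_of_opNorm_le _ (h1 _) _
    have t2 : ‖(fderiv ℝ g (L d₁ d₂ t) - fderiv ℝ g (L b₁ b₂ t)) ((b₁ - a₁) - (b₂ - a₂))‖ ≤
        M * q * ‖(b₁ - a₁) - (b₂ - a₂)‖ + M * r * (2 * Ω) := by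
      calc _ ≤ (M * ‖L d₁ d₂ t - L b₁ b₂ t‖) * ‖(b₁ - a₁) - (b₂ - a₂)‖ :=
            ContinuousLinearMap.le_of_opNorm_le _ (norm_sub_le_of_fderiv hg' h2 _ _) _
        _ ≤ (M * (q + r)) * ‖(b₁ - a₁) - (b₂ - a₂)‖ := by gcongr
        _ = M * q * ‖(b₁ - a₁) - (b₂ - a₂)‖ + M * r * ‖(b₁ - a₁) - (b₂ - a₂)‖ := by ring
        _ ≤ _ := by gcongr
    have t3 : ‖(fderiv ℝ g (L d₁ d₂ t) - fderiv ℝ g (L c₁ c₂ t)) ((c₁ - a₁) - (c₂ - a₂))‖ ≤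
        M * p * ‖(c₁ - a₁) - (c₂ - a₂)‖ + M * r * (2 * Ω) := by
      calc _ ≤ (M * ‖L d₁ d₂ t - L c₁ c₂ t‖) * ‖(c₁ - a₁) - (c₂ - a₂)‖ :=
            ContinuousLinearMap.le_of_opNorm_le _ (norm_sub_le_of_fderiv hg' h2 _ _) _
        _ ≤ (M * (p + r)) * ‖(c₁ - a₁) - (c₂ - a₂)‖ := by gcongr
        _ = M * p * ‖(c₁ - a₁) - (c₂ - a₂)‖ + M * r * ‖(c₁ - a₁) - (c₂ - a₂)‖ := by ring
        _ ≤ _ := by gcongr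
    have t4 : ‖(fderiv ℝ g (L d₁ d₂ t) - fderiv ℝ g (L b₁ b₂ t) - fderiv ℝ g (L c₁ c₂ t) +
          fderiv ℝ g (L a₁ a₂ t)) (a₁ - a₂)‖ ≤ (M * r + M * p * q) * Ω := by
      calc _ ≤ (M * ‖L d₁ d₂ t - L b₁ b₂ t - L c₁ c₂ t + L a₁ a₂ t‖ +
              M * ‖L b₁ b₂ t - L a₁ a₂ t‖ * ‖L c₁ c₂ t - L a₁ a₂ t‖) * ‖a₁ - a₂‖ :=
            ContinuousLinearMap.le_of_opNorm_le _ (norm_four_point_le hg' hg'' h2 h3 _ _ _ _) _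
        _ ≤ _ := by gcongr
    rw [e]
    refine (norm_add_le _ _).trans ((add_le_add ((norm_add_le _ _).trans (add_le_add
      ((norm_add_le _ _).trans (add_le_add t1 t2)) t3)) t4).trans (le_of_eq ?_))
    ring
  have := norm_sub_le_of_hasDerivAt_segment hd hbd
  simp only [hL, one_smul, zero_smul, add_zero, add_sub_cancel] at this
  exact this

end Pointwise

/-! ### Iterated Fréchet derivatives bounded by the C_b^k norm. -/

section BoundedDerivatives

theorem norm_iteratedFDeriv_le_of_memCb {k j : ℕ} {σ : Plane → Plane} (hσ : cbNorm k σ < ∞)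
    (hj : j ≤ k) (x : Plane) : ‖iteratedFDeriv ℝ j σ x‖ ≤ (cbNorm k σ).toNNReal := by
  have h1 : ‖iteratedFDeriv ℝ j σ x‖ₑ ≤ cbNorm k σ :=
    (le_iSup (fun x => ‖iteratedFDeriv ℝ j σ x‖ₑ) x).trans
      (Finset.single_le_sum (f := fun j => ⨆ x, ‖iteratedFDeriv ℝ j σ x‖ₑ) (fun _ _ => zero_le)
        (Finset.mem_range.2 (Nat.lt_succ_of_le hj)))
  have := ENNReal.toReal_mono hσ.ne h1
  rwa [toReal_enorm] at this

theorem norm_fderiv_le_of_memCb {k : ℕ} {σ : Plane → Plane} (hσ : cbNorm k σ < ∞)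
    (hk : 1 ≤ k) (x : Plane) : ‖fderiv ℝ σ x‖ ≤ (cbNorm k σ).toNNReal := by
  rw [← norm_iteratedFDeriv_one]
  exact norm_iteratedFDeriv_le_of_memCb hσ hk x

theorem norm_fderiv_fderiv_le_of_memCb {k : ℕ} {σ : Plane → Plane} (hσ : cbNorm k σ < ∞)
    (hk : 2 ≤ k) (x : Plane) : ‖fderiv ℝ (fderiv ℝ σ) x‖ ≤ (cbNorm k σ).toNNReal := by
  rw [← norm_iteratedFDeriv_one, norm_iteratedFDeriv_fderiv]
  exact norm_iteratedFDeriv_le_of_memCb hσ hk x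

set_option maxSynthPendingDepth 10 in
theorem norm_fderiv_fderiv_fderiv_le_of_memCb {k : ℕ} {σ : Plane → Plane} (hσ : cbNorm k σ < ∞)
    (hk : 3 ≤ k) (x : Plane) :
    ‖fderiv ℝ (fderiv ℝ (fderiv ℝ σ)) x‖ ≤ (cbNorm k σ).toNNReal := by
  rw [← norm_iteratedFDeriv_one, norm_iteratedFDeriv_fderiv, norm_iteratedFDeriv_fderiv]
  exact norm_iteratedFDeriv_le_of_memCb hσ hk x

theorem cbNorm_mono (σ : Plane → Plane) {k l : ℕ} (h : k ≤ l) : cbNorm k σ ≤ cbNorm l σ :=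
  Finset.sum_le_sum_of_subset (Finset.range_mono (by omega))

end BoundedDerivatives

/-! ### Composition estimates in the difference norm. -/

section Nemytskii

variable {E : Type*} [NormedAddCommGroup E]

theorem diffFst_diffSnd_apply (h k : ℝ) (F : ℝ → ℝ → E) (x y : ℝ) :
    diffFst h (diffSnd k F) x y = F (x + h) (y + k) - F (x + h) y - F x (y + k) + F x y := by
  simp only [diffFst, diffSnd]; abel

/-- With a single integral over a product measure, a pointwise inequality integrates by one use of
monotonicity. -/
theorem lintegral_mixed_eq_lintegral_prod (a b : ℝ) {φ : (ℝ × ℝ) × ℝ × ℝ → ℝ≥0∞}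
    (hφ : Measurable φ) :
    ∫⁻ h, (∫⁻ k, (∫⁻ x, ∫⁻ y, φ ((h, k), x, y)) ∂(fracMeasure b)) ∂(fracMeasure a) =
      ∫⁻ p, φ p ∂(((fracMeasure a).prod (fracMeasure b)).prod volume) := by
  rw [lintegral_prod _ hφ.aemeasurable, lintegral_prod _ hφ.lintegral_prod_right'.aemeasurable]
  refine lintegral_congr fun h => lintegral_congr fun k => ?_
  rw [Measure.volume_eq_prod, lintegral_prod _ (by fun_prop)]

theorem lintegral_single_eq_lintegral_prod (a : ℝ) {φ : ℝ × ℝ × ℝ → ℝ≥0∞}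
    (hφ : Measurable φ) :
    ∫⁻ h, (∫⁻ x, ∫⁻ y, φ (h, x, y)) ∂(fracMeasure a) =
      ∫⁻ p, φ p ∂((fracMeasure a).prod volume) := by
  rw [lintegral_prod _ hφ.aemeasurable]
  refine lintegral_congr fun h => ?_
  rw [Measure.volume_eq_prod, lintegral_prod _ (by fun_prop)]

theorem sqNorm_eq_lintegral_prod [MeasurableSpace E] [BorelSpace E] {F : ℝ → ℝ → E}
    (hF : Measurable (Function.uncurry F)) :
    sqNorm F = ∫⁻ p : ℝ × ℝ, ‖F p.1 p.2‖ₑ ^ 2 := by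
  have hm : Measurable fun p : ℝ × ℝ => ‖F p.1 p.2‖ₑ ^ 2 := hF.enorm.pow_const 2
  rw [Measure.volume_eq_prod, lintegral_prod _ hm.aemeasurable]
  rfl

variable [MeasurableSpace E] [BorelSpace E] [SecondCountableTopology E]

/-- The integral of the product of a first difference of `F` and a second difference of `G`. -/
noncomputable def crossNorm (a b : ℝ) (F G : ℝ → ℝ → E) : ℝ≥0∞ :=
  ∫⁻ h, (∫⁻ k, (∫⁻ x, ∫⁻ y, ‖diffFst h F x y‖ₑ ^ 2 * ‖diffSnd k G x y‖ₑ ^ 2)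
        ∂(fracMeasure b)) ∂(fracMeasure a)

/-- The integral of the mixed second differences. -/
noncomputable def mixedNorm (a b : ℝ) (F : ℝ → ℝ → E) : ℝ≥0∞ :=
  ∫⁻ h, (∫⁻ k, sqNorm (diffFst h (diffSnd k F)) ∂(fracMeasure b)) ∂(fracMeasure a)

theorem measurable_cross {F G : ℝ → ℝ → E} (hF : Measurable (Function.uncurry F))
    (hG : Measurable (Function.uncurry G)) :
    Measurable fun p : (ℝ × ℝ) × ℝ × ℝ =>
      ‖diffFst p.1.1 F p.2.1 p.2.2‖ₑ ^ 2 * ‖diffSnd p.1.2 G p.2.1 p.2.2‖ₑ ^ 2 :=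
  (((measurable_diffFst hF).enorm.pow_const 2).comp
    (f := fun p : (ℝ × ℝ) × ℝ × ℝ => (p.1.1, p.2.1, p.2.2)) (by fun_prop)).mul
  (((measurable_diffSnd hG).enorm.pow_const 2).comp
    (f := fun p : (ℝ × ℝ) × ℝ × ℝ => (p.1.2, p.2.1, p.2.2)) (by fun_prop))

theorem crossNorm_eq (a b : ℝ) {F G : ℝ → ℝ → E} (hF : Measurable (Function.uncurry F))
    (hG : Measurable (Function.uncurry G)) :
    crossNorm a b F G = ∫⁻ p : (ℝ × ℝ) × ℝ × ℝ, ‖diffFst p.1.1 F p.2.1 p.2.2‖ₑ ^ 2 *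
      ‖diffSnd p.1.2 G p.2.1 p.2.2‖ₑ ^ 2 ∂(((fracMeasure a).prod (fracMeasure b)).prod volume) :=
  lintegral_mixed_eq_lintegral_prod a b (measurable_cross hF hG)

theorem mixedNorm_eq (a b : ℝ) {F : ℝ → ℝ → E} (hF : Measurable (Function.uncurry F)) :
    mixedNorm a b F = ∫⁻ p : (ℝ × ℝ) × ℝ × ℝ, ‖diffFst p.1.1 (diffSnd p.1.2 F) p.2.1 p.2.2‖ₑ ^ 2
      ∂(((fracMeasure a).prod (fracMeasure b)).prod volume) :=
  lintegral_mixed_eq_lintegral_prod a b ((measurable_diffFst_diffSnd hF).enorm.pow_const 2)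

theorem lintegral_sqNorm_diffFst_eq (a : ℝ) {F : ℝ → ℝ → E}
    (hF : Measurable (Function.uncurry F)) :
    ∫⁻ h, sqNorm (diffFst h F) ∂(fracMeasure a) =
      ∫⁻ p : ℝ × ℝ × ℝ, ‖diffFst p.1 F p.2.1 p.2.2‖ₑ ^ 2 ∂((fracMeasure a).prod volume) :=
  lintegral_single_eq_lintegral_prod a ((measurable_diffFst hF).enorm.pow_const 2)

theorem lintegral_sqNorm_diffSnd_eq (a : ℝ) {F : ℝ → ℝ → E}
    (hF : Measurable (Function.uncurry F)) :
    ∫⁻ h, sqNorm (diffSnd h F) ∂(fracMeasure a) =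
      ∫⁻ p : ℝ × ℝ × ℝ, ‖diffSnd p.1 F p.2.1 p.2.2‖ₑ ^ 2 ∂((fracMeasure a).prod volume) :=
  lintegral_single_eq_lintegral_prod a ((measurable_diffSnd hF).enorm.pow_const 2)

omit [MeasurableSpace E] [BorelSpace E] [SecondCountableTopology E] in
theorem diffNorm_eq (a b : ℝ) (F : ℝ → ℝ → E) :
    diffNorm a b F = sqNorm F + (∫⁻ h, sqNorm (diffFst h F) ∂(fracMeasure a)) +
      (∫⁻ k, sqNorm (diffSnd k F) ∂(fracMeasure b)) + mixedNorm a b F := rfl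

variable [NormedSpace ℝ E]

theorem mixedNorm_comp_le (a b : ℝ) {g : E → E} {M : ℝ≥0} (hg : Differentiable ℝ g)
    (hg' : Differentiable ℝ (fderiv ℝ g)) (h1 : ∀ x, ‖fderiv ℝ g x‖ ≤ M)
    (h2 : ∀ x, ‖fderiv ℝ (fderiv ℝ g) x‖ ≤ M) {F : ℝ → ℝ → E}
    (hF : Measurable (Function.uncurry F)) :
    mixedNorm a b (fun x y => g (F x y)) ≤
      2 * M ^ 2 * (mixedNorm a b F + crossNorm a b F F) := by
  have hgF : Measurable (Function.uncurry fun x y => g (F x y)) := hg.continuous.measurable.comp hF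
  rw [mixedNorm_eq a b hgF, mixedNorm_eq a b hF, crossNorm_eq a b hF hF,
    ← lintegral_add_right _ (measurable_cross hF hF), ← lintegral_const_mul' _ _ (by finiteness)]
  refine lintegral_mono fun p => ?_
  obtain ⟨⟨h, k⟩, x, y⟩ := p
  dsimp only
  have key := norm_four_point_le hg hg' h1 h2 (F x y) (F (x + h) y) (F x (y + k))
    (F (x + h) (y + k))
  rw [← diffFst_diffSnd_apply, ← diffFst_diffSnd_apply h k (fun x y => g (F x y))] at key
  change _ ≤ _ * _ + _ * ‖diffFst h F x y‖ * ‖diffSnd k F x y‖ at key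
  simp only [enorm_eq_nnnorm]
  norm_cast
  rw [← NNReal.coe_le_coe]
  push_cast
  set P := ‖diffFst h (diffSnd k F) x y‖
  set R := ‖diffFst h F x y‖ * ‖diffSnd k F x y‖ with hR
  calc _ ≤ (M * P + M * R) ^ 2 := by
        gcongr
        rwa [hR, ← mul_assoc]
    _ ≤ 2 * M ^ 2 * (P ^ 2 + R ^ 2) := by
        nlinarith [mul_nonneg (sq_nonneg (M : ℝ)) (sq_nonneg (P - R))]
    _ = _ := by rw [hR]; ring

omit [MeasurableSpace E] [BorelSpace E] [SecondCountableTopology E] [NormedSpace ℝ E] in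
theorem lintegral_enorm_sq_le {α : Type*} [MeasurableSpace α] (μ : Measure α) (c : ℝ≥0)
    {φ ψ : α → E} (h : ∀ x, ‖φ x‖ ≤ c * ‖ψ x‖) :
    ∫⁻ x, ‖φ x‖ₑ ^ 2 ∂μ ≤ c ^ 2 * ∫⁻ x, ‖ψ x‖ₑ ^ 2 ∂μ := by
  rw [← lintegral_const_mul' _ _ (by finiteness)]
  refine lintegral_mono fun x => ?_
  have := h x
  simp only [enorm_eq_nnnorm]
  norm_cast
  rw [← NNReal.coe_le_coe]
  push_cast
  rw [← mul_pow]
  gcongr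

/-- Composition with a `C²` function with bounded derivatives that vanishes at the origin. -/
theorem exists_diffNorm_comp_le (E : Type*) [NormedAddCommGroup E]
    [MeasurableSpace E] [BorelSpace E] [SecondCountableTopology E] [NormedSpace ℝ E]
    [CompleteSpace E] {a b : ℝ} (ha : 1 / 2 < a) (hb : 1 / 2 < b) :
    ∃ C : ℝ≥0, ∀ (g : E → E) (M : ℝ≥0), Differentiable ℝ g → Differentiable ℝ (fderiv ℝ g) →
      (∀ x, ‖fderiv ℝ g x‖ ≤ M) → (∀ x, ‖fderiv ℝ (fderiv ℝ g) x‖ ≤ M) → g 0 = 0 →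
      ∀ F : ℝ → ℝ → E, Measurable (Function.uncurry F) →
      diffNorm a b (fun x y => g (F x y)) ≤
        C * M ^ 2 * diffNorm a b F * (1 + diffNorm a b F) := by
  obtain ⟨K, hK⟩ := exists_lintegral_diffFst_mul_diffSnd_le E ha hb
  refine ⟨2 + 2 * K, fun g M hg hg' h1 h2 h0 F hF => ?_⟩
  have hgF : Measurable (Function.uncurry fun x y => g (F x y)) := hg.continuous.measurable.comp hF
  set Q := diffNorm a b F with hQ
  -- The condition g 0 = 0 enters here: it makes ‖g (F x y)‖ at most M‖F x y‖.
  have s0 : sqNorm (fun x y => g (F x y)) ≤ M ^ 2 * sqNorm F := by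
    rw [sqNorm_eq_lintegral_prod hgF, sqNorm_eq_lintegral_prod hF]
    refine lintegral_enorm_sq_le _ M fun p => ?_
    simpa [h0] using norm_sub_le_of_fderiv hg h1 0 (F p.1 p.2)
  have s1 : ∫⁻ h, sqNorm (diffFst h fun x y => g (F x y)) ∂(fracMeasure a) ≤
      M ^ 2 * ∫⁻ h, sqNorm (diffFst h F) ∂(fracMeasure a) := by
    rw [lintegral_sqNorm_diffFst_eq a hgF, lintegral_sqNorm_diffFst_eq a hF]
    exact lintegral_enorm_sq_le _ M fun p => norm_sub_le_of_fderiv hg h1 _ _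
  have s2 : ∫⁻ k, sqNorm (diffSnd k fun x y => g (F x y)) ∂(fracMeasure b) ≤
      M ^ 2 * ∫⁻ k, sqNorm (diffSnd k F) ∂(fracMeasure b) := by
    rw [lintegral_sqNorm_diffSnd_eq b hgF, lintegral_sqNorm_diffSnd_eq b hF]
    exact lintegral_enorm_sq_le _ M fun p => norm_sub_le_of_fderiv hg h1 _ _
  have s3 := mixedNorm_comp_le a b hg hg' h1 h2 hF
  have s4 : crossNorm a b F F ≤ K * Q * Q := hK F F hF hF
  calc _ ≤ M ^ 2 * sqNorm F + M ^ 2 * (∫⁻ h, sqNorm (diffFst h F) ∂(fracMeasure a)) +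
        M ^ 2 * (∫⁻ k, sqNorm (diffSnd k F) ∂(fracMeasure b)) +
        2 * M ^ 2 * (mixedNorm a b F + crossNorm a b F F) := by
        rw [diffNorm_eq]; gcongr
    _ ≤ 2 * (M ^ 2 * sqNorm F + M ^ 2 * (∫⁻ h, sqNorm (diffFst h F) ∂(fracMeasure a)) +
        M ^ 2 * (∫⁻ k, sqNorm (diffSnd k F) ∂(fracMeasure b))) +
        2 * M ^ 2 * (mixedNorm a b F + K * Q * Q) := by
        gcongr
        rw [two_mul]; exact le_self_add
    _ = 2 * M ^ 2 * Q + 2 * M ^ 2 * (K * Q * Q) := by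
        rw [hQ, diffNorm_eq]; ring
    -- Nonnegative terms are added so that the polynomial factorises as (2 + 2K) M² Q (1 + Q).
    _ ≤ (2 * M ^ 2 * Q + 2 * M ^ 2 * (K * Q * Q)) + (2 * M ^ 2 * Q ^ 2 + 2 * K * M ^ 2 * Q) :=
        le_self_add
    _ = _ := by push_cast; ring

theorem sq_sum_five_le (x₁ x₂ x₃ x₄ x₅ : ℝ) : (x₁ + x₂ + x₃ + x₄ + x₅) ^ 2 ≤
    5 * (x₁ ^ 2 + x₂ ^ 2 + x₃ ^ 2 + x₄ ^ 2 + x₅ ^ 2) := by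
  nlinarith [sq_nonneg (x₁ - x₂), sq_nonneg (x₁ - x₃), sq_nonneg (x₁ - x₄), sq_nonneg (x₁ - x₅),
    sq_nonneg (x₂ - x₃), sq_nonneg (x₂ - x₄), sq_nonneg (x₂ - x₅), sq_nonneg (x₃ - x₄),
    sq_nonneg (x₃ - x₅), sq_nonneg (x₄ - x₅)]

/-- Cauchy–Schwarz on the five terms gives 5, and each squared sum of two another 2: hence 10 = 5·2,
250 = 5·25·2 and 20 = 5·2·2. -/
theorem sq_five_term_le {M Ω e r₁ r₂ wh wk p₁ p₂ q₁ q₂ : ℝ} :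
    (M * (e + (q₁ + q₂) * wh + (p₁ + p₂) * wk + 5 * Ω * (r₁ + r₂) +
      Ω * (p₁ + p₂) * (q₁ + q₂))) ^ 2 ≤ M ^ 2 * (5 * e ^ 2 + 10 * (wh ^ 2 * q₁ ^ 2) +
        10 * (wh ^ 2 * q₂ ^ 2) + 10 * (p₁ ^ 2 * wk ^ 2) + 10 * (p₂ ^ 2 * wk ^ 2) +
        250 * Ω ^ 2 * (r₁ ^ 2 + r₂ ^ 2) + 20 * Ω ^ 2 * (p₁ ^ 2 * q₁ ^ 2 + p₁ ^ 2 * q₂ ^ 2 +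
          p₂ ^ 2 * q₁ ^ 2 + p₂ ^ 2 * q₂ ^ 2)) := by
  rw [mul_pow]
  refine mul_le_mul_of_nonneg_left ((sq_sum_five_le _ _ _ _ _).trans ?_) (sq_nonneg M)
  have hq : (q₁ + q₂) ^ 2 ≤ 2 * (q₁ ^ 2 + q₂ ^ 2) := by nlinarith [sq_nonneg (q₁ - q₂)]
  have hp : (p₁ + p₂) ^ 2 ≤ 2 * (p₁ ^ 2 + p₂ ^ 2) := by nlinarith [sq_nonneg (p₁ - p₂)]
  have hr : (r₁ + r₂) ^ 2 ≤ 2 * (r₁ ^ 2 + r₂ ^ 2) := by nlinarith [sq_nonneg (r₁ - r₂)]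
  calc _ = 5 * (e ^ 2 + (q₁ + q₂) ^ 2 * wh ^ 2 + (p₁ + p₂) ^ 2 * wk ^ 2 +
        25 * Ω ^ 2 * (r₁ + r₂) ^ 2 + Ω ^ 2 * ((p₁ + p₂) ^ 2 * (q₁ + q₂) ^ 2)) := by ring
    _ ≤ 5 * (e ^ 2 + (2 * (q₁ ^ 2 + q₂ ^ 2)) * wh ^ 2 + (2 * (p₁ ^ 2 + p₂ ^ 2)) * wk ^ 2 +
        25 * Ω ^ 2 * (2 * (r₁ ^ 2 + r₂ ^ 2)) +
        Ω ^ 2 * ((2 * (p₁ ^ 2 + p₂ ^ 2)) * (2 * (q₁ ^ 2 + q₂ ^ 2)))) := by gcongr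
    _ = _ := by ring

-- The square of `norm_diff_four_point_le`, integrated: each product of first differences becomes a
-- `crossNorm`, and Ω, being constant, leaves the integral.
set_option maxSynthPendingDepth 10 in
theorem mixedNorm_comp_sub_comp_le (a b : ℝ) {g : E → E} {M Ω : ℝ≥0} (hg : Differentiable ℝ g)
    (hg' : Differentiable ℝ (fderiv ℝ g)) (hg'' : Differentiable ℝ (fderiv ℝ (fderiv ℝ g)))
    (h1 : ∀ x, ‖fderiv ℝ g x‖ ≤ M) (h2 : ∀ x, ‖fderiv ℝ (fderiv ℝ g) x‖ ≤ M)
    (h3 : ∀ x, ‖fderiv ℝ (fderiv ℝ (fderiv ℝ g)) x‖ ≤ M)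
    {F₁ F₂ : ℝ → ℝ → E}
    (hF₁ : Measurable (Function.uncurry F₁)) (hF₂ : Measurable (Function.uncurry F₂))
    (hΩ : ∀ x y, ‖F₁ x y - F₂ x y‖ ≤ Ω) :
    mixedNorm a b (fun x y => g (F₁ x y) - g (F₂ x y)) ≤
      M ^ 2 * (5 * mixedNorm a b (fun x y => F₁ x y - F₂ x y) +
        10 * crossNorm a b (fun x y => F₁ x y - F₂ x y) F₁ +
        10 * crossNorm a b (fun x y => F₁ x y - F₂ x y) F₂ +
        10 * crossNorm a b F₁ (fun x y => F₁ x y - F₂ x y) +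
        10 * crossNorm a b F₂ (fun x y => F₁ x y - F₂ x y) +
        250 * Ω ^ 2 * (mixedNorm a b F₁ + mixedNorm a b F₂) +
        20 * Ω ^ 2 * (crossNorm a b F₁ F₁ + crossNorm a b F₁ F₂ + crossNorm a b F₂ F₁ +
          crossNorm a b F₂ F₂)) := by
  set w : ℝ → ℝ → E := fun x y => F₁ x y - F₂ x y with hw
  have mw : Measurable (Function.uncurry w) := hF₁.sub hF₂
  have mg : Measurable (Function.uncurry fun x y => g (F₁ x y) - g (F₂ x y)) :=
    (hg.continuous.measurable.comp hF₁).sub (hg.continuous.measurable.comp hF₂)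
  have mD : ∀ {F : ℝ → ℝ → E}, Measurable (Function.uncurry F) →
      Measurable fun p : (ℝ × ℝ) × ℝ × ℝ => ‖diffFst p.1.1 (diffSnd p.1.2 F) p.2.1 p.2.2‖ₑ ^ 2 :=
    fun hF => (measurable_diffFst_diffSnd hF).enorm.pow_const 2
  rw [mixedNorm_eq a b mg, mixedNorm_eq a b mw, mixedNorm_eq a b hF₁, mixedNorm_eq a b hF₂,
    crossNorm_eq a b mw hF₁, crossNorm_eq a b mw hF₂, crossNorm_eq a b hF₁ mw,
    crossNorm_eq a b hF₂ mw, crossNorm_eq a b hF₁ hF₁, crossNorm_eq a b hF₁ hF₂,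
    crossNorm_eq a b hF₂ hF₁, crossNorm_eq a b hF₂ hF₂,
    ← lintegral_add_right _ (measurable_cross hF₁ hF₂),
    ← lintegral_add_right _ (measurable_cross hF₂ hF₁),
    ← lintegral_add_right _ (measurable_cross hF₂ hF₂),
    ← lintegral_add_right _ (mD hF₂)]
  simp_rw [← lintegral_const_mul' (5 : ℝ≥0∞) _ (by finiteness),
    ← lintegral_const_mul' (10 : ℝ≥0∞) _ (by finiteness),
    ← lintegral_const_mul' (250 * Ω ^ 2 : ℝ≥0∞) _ (by finiteness),
    ← lintegral_const_mul' (20 * Ω ^ 2 : ℝ≥0∞) _ (by finiteness)]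
  rw [← lintegral_add_right _ ((measurable_cross mw hF₁).const_mul _),
    ← lintegral_add_right _ ((measurable_cross mw hF₂).const_mul _),
    ← lintegral_add_right _ ((measurable_cross hF₁ mw).const_mul _),
    ← lintegral_add_right _ ((measurable_cross hF₂ mw).const_mul _),
    ← lintegral_add_right _ (((mD hF₁).fun_add (mD hF₂)).const_mul _),
    ← lintegral_add_right _ (((((measurable_cross hF₁ hF₁).fun_add (measurable_cross hF₁ hF₂)).fun_add
      (measurable_cross hF₂ hF₁)).fun_add (measurable_cross hF₂ hF₂)).const_mul _),
    ← lintegral_const_mul' _ _ (by finiteness)]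
  refine lintegral_mono fun p => ?_
  obtain ⟨⟨h, k⟩, x, y⟩ := p
  dsimp only [Pi.add_apply]
  have key := norm_diff_four_point_le (NNReal.coe_nonneg M) hg hg' hg'' h1 h2 h3
    (F₁ x y) (F₁ (x + h) y) (F₁ x (y + k)) (F₁ (x + h) (y + k))
    (F₂ x y) (F₂ (x + h) y) (F₂ x (y + k)) (F₂ (x + h) (y + k)) (hΩ _ _) (hΩ _ _) (hΩ _ _)
  have e0 : (g (F₁ (x + h) (y + k)) - g (F₁ (x + h) y) - g (F₁ x (y + k)) + g (F₁ x y)) -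
      (g (F₂ (x + h) (y + k)) - g (F₂ (x + h) y) - g (F₂ x (y + k)) + g (F₂ x y)) =
      diffFst h (diffSnd k fun x y => g (F₁ x y) - g (F₂ x y)) x y := by
    rw [diffFst_diffSnd_apply]; abel
  have e1 : (F₁ (x + h) (y + k) - F₁ (x + h) y - F₁ x (y + k) + F₁ x y) -
      (F₂ (x + h) (y + k) - F₂ (x + h) y - F₂ x (y + k) + F₂ x y) =
      diffFst h (diffSnd k w) x y := by
    rw [diffFst_diffSnd_apply]; simp only [hw]; abel
  have e2 : (F₁ (x + h) y - F₁ x y) - (F₂ (x + h) y - F₂ x y) = diffFst h w x y := by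
    simp only [diffFst, hw]; abel
  have e3 : (F₁ x (y + k) - F₁ x y) - (F₂ x (y + k) - F₂ x y) = diffSnd k w x y := by
    simp only [diffSnd, hw]; abel
  rw [e0, e1, e2, e3, ← diffFst_diffSnd_apply, ← diffFst_diffSnd_apply] at key
  change _ ≤ M * (_ + (‖diffSnd k F₁ x y‖ + ‖diffSnd k F₂ x y‖) * _ +
    (‖diffFst h F₁ x y‖ + ‖diffFst h F₂ x y‖) * _ + _ +
    Ω * (‖diffFst h F₁ x y‖ + ‖diffFst h F₂ x y‖) *
      (‖diffSnd k F₁ x y‖ + ‖diffSnd k F₂ x y‖)) at key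
  simp only [enorm_eq_nnnorm]
  norm_cast
  rw [← NNReal.coe_le_coe]
  push_cast
  have hX := norm_nonneg (diffFst h (diffSnd k fun x y => g (F₁ x y) - g (F₂ x y)) x y)
  generalize ‖diffFst h (diffSnd k fun x y => g (F₁ x y) - g (F₂ x y)) x y‖ = X at *
  generalize ‖diffFst h (diffSnd k w) x y‖ = e at *
  generalize ‖diffFst h (diffSnd k F₁) x y‖ = r₁ at *
  generalize ‖diffFst h (diffSnd k F₂) x y‖ = r₂ at *
  generalize ‖diffFst h w x y‖ = wh at *
  generalize ‖diffSnd k w x y‖ = wk at *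
  generalize ‖diffFst h F₁ x y‖ = p₁ at *
  generalize ‖diffFst h F₂ x y‖ = p₂ at *
  generalize ‖diffSnd k F₁ x y‖ = q₁ at *
  generalize ‖diffSnd k F₂ x y‖ = q₂ at *
  exact (pow_le_pow_left₀ hX key 2).trans sq_five_term_le

omit [SecondCountableTopology E] [NormedSpace ℝ E] in
theorem lintegral_enorm_sq_two_le {α : Type*} [MeasurableSpace α] (μ : Measure α) (M Ω : ℝ≥0)
    {φ w ψ₁ ψ₂ : α → E} (mψ₁ : Measurable ψ₁) (mψ₂ : Measurable ψ₂)
    (h : ∀ x, ‖φ x‖ ≤ M * ‖w x‖ + M * Ω * (‖ψ₁ x‖ + ‖ψ₂ x‖)) :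
    ∫⁻ x, ‖φ x‖ₑ ^ 2 ∂μ ≤ M ^ 2 * (2 * (∫⁻ x, ‖w x‖ₑ ^ 2 ∂μ) +
      4 * Ω ^ 2 * ((∫⁻ x, ‖ψ₁ x‖ₑ ^ 2 ∂μ) + ∫⁻ x, ‖ψ₂ x‖ₑ ^ 2 ∂μ)) := by
  rw [← lintegral_add_right _ (mψ₂.enorm.pow_const 2), ← lintegral_const_mul' _ _ (by finiteness),
    ← lintegral_const_mul' _ _ (by finiteness),
    ← lintegral_add_right _ (((mψ₁.enorm.pow_const 2).fun_add (mψ₂.enorm.pow_const 2)).const_mul _),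
    ← lintegral_const_mul' _ _ (by finiteness)]
  refine lintegral_mono fun x => ?_
  have := h x
  dsimp only [Pi.add_apply]
  simp only [enorm_eq_nnnorm]
  norm_cast
  rw [← NNReal.coe_le_coe]
  push_cast
  set P := ‖ψ₁ x‖ + ‖ψ₂ x‖ with hP
  have hP' : P ^ 2 ≤ 2 * (‖ψ₁ x‖ ^ 2 + ‖ψ₂ x‖ ^ 2) := by nlinarith [sq_nonneg (‖ψ₁ x‖ - ‖ψ₂ x‖)]
  calc _ ≤ (M * ‖w x‖ + M * Ω * P) ^ 2 := by gcongr
    _ ≤ M ^ 2 * (2 * ‖w x‖ ^ 2 + 2 * Ω ^ 2 * P ^ 2) := by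
        nlinarith [mul_nonneg (sq_nonneg (M : ℝ)) (sq_nonneg (‖w x‖ - Ω * P))]
    _ ≤ M ^ 2 * (2 * ‖w x‖ ^ 2 + 2 * Ω ^ 2 * (2 * (‖ψ₁ x‖ ^ 2 + ‖ψ₂ x‖ ^ 2))) := by gcongr
    _ = _ := by ring

set_option maxSynthPendingDepth 10 in
/-- The difference of the compositions of two functions, whose difference is bounded, with a `C³`
function with bounded derivatives. -/
theorem exists_diffNorm_comp_sub_comp_le (E : Type*) [NormedAddCommGroup E]
    [MeasurableSpace E] [BorelSpace E] [SecondCountableTopology E] [NormedSpace ℝ E]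
    [CompleteSpace E] {a b : ℝ} (ha : 1 / 2 < a) (hb : 1 / 2 < b) :
    ∃ C : ℝ≥0, ∀ (g : E → E) (M Ω : ℝ≥0), Differentiable ℝ g → Differentiable ℝ (fderiv ℝ g) →
      Differentiable ℝ (fderiv ℝ (fderiv ℝ g)) →
      (∀ x, ‖fderiv ℝ g x‖ ≤ M) → (∀ x, ‖fderiv ℝ (fderiv ℝ g) x‖ ≤ M) →
      (∀ x, ‖fderiv ℝ (fderiv ℝ (fderiv ℝ g)) x‖ ≤ M) →
      ∀ F₁ F₂ : ℝ → ℝ → E, Measurable (Function.uncurry F₁) → Measurable (Function.uncurry F₂) →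
      (∀ x y, ‖F₁ x y - F₂ x y‖ ≤ Ω) →
      diffNorm a b (fun x y => g (F₁ x y) - g (F₂ x y)) ≤
        C * M ^ 2 * (diffNorm a b (fun x y => F₁ x y - F₂ x y) + Ω ^ 2) *
          (1 + (diffNorm a b F₁ + diffNorm a b F₂) + (diffNorm a b F₁ + diffNorm a b F₂) ^ 2) := by
  obtain ⟨K, hK⟩ := exists_lintegral_diffFst_mul_diffSnd_le E ha hb
  refine ⟨250 + 20 * K, fun g M Ω hg hg' hg'' h1 h2 h3 F₁ F₂ hF₁ hF₂ hΩ => ?_⟩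
  set w : ℝ → ℝ → E := fun x y => F₁ x y - F₂ x y with hw
  set G : ℝ → ℝ → E := fun x y => g (F₁ x y) - g (F₂ x y) with hG
  have mw : Measurable (Function.uncurry w) := hF₁.sub hF₂
  have mg : Measurable (Function.uncurry G) :=
    (hg.continuous.measurable.comp hF₁).sub (hg.continuous.measurable.comp hF₂)
  set q := diffNorm a b w with hq
  set Q₁ := diffNorm a b F₁ with hQ₁
  set Q₂ := diffNorm a b F₂ with hQ₂
  have s0 : sqNorm G ≤ M ^ 2 * sqNorm w := by
    rw [sqNorm_eq_lintegral_prod mg, sqNorm_eq_lintegral_prod mw]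
    exact lintegral_enorm_sq_le _ M fun p => norm_sub_le_of_fderiv hg h1 _ _
  have s1 : ∫⁻ h, sqNorm (diffFst h G) ∂(fracMeasure a) ≤
      M ^ 2 * (2 * (∫⁻ h, sqNorm (diffFst h w) ∂(fracMeasure a)) + 4 * Ω ^ 2 *
        ((∫⁻ h, sqNorm (diffFst h F₁) ∂(fracMeasure a)) +
          ∫⁻ h, sqNorm (diffFst h F₂) ∂(fracMeasure a))) := by
    rw [lintegral_sqNorm_diffFst_eq a mg, lintegral_sqNorm_diffFst_eq a mw,
      lintegral_sqNorm_diffFst_eq a hF₁, lintegral_sqNorm_diffFst_eq a hF₂]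
    exact lintegral_enorm_sq_two_le _ M Ω (measurable_diffFst hF₁) (measurable_diffFst hF₂)
      fun p => norm_diff_two_point_le M.2 hg hg' h1 h2 _ _ _ _ (hΩ _ _)
  have s2 : ∫⁻ k, sqNorm (diffSnd k G) ∂(fracMeasure b) ≤
      M ^ 2 * (2 * (∫⁻ k, sqNorm (diffSnd k w) ∂(fracMeasure b)) + 4 * Ω ^ 2 *
        ((∫⁻ k, sqNorm (diffSnd k F₁) ∂(fracMeasure b)) +
          ∫⁻ k, sqNorm (diffSnd k F₂) ∂(fracMeasure b))) := by
    rw [lintegral_sqNorm_diffSnd_eq b mg, lintegral_sqNorm_diffSnd_eq b mw,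
      lintegral_sqNorm_diffSnd_eq b hF₁, lintegral_sqNorm_diffSnd_eq b hF₂]
    exact lintegral_enorm_sq_two_le _ M Ω (measurable_diffSnd hF₁) (measurable_diffSnd hF₂)
      fun p => norm_diff_two_point_le M.2 hg hg' h1 h2 _ _ _ _ (hΩ _ _)
  have s3 := mixedNorm_comp_sub_comp_le a b hg hg' hg'' h1 h2 h3 hF₁ hF₂ hΩ
  have c : ∀ {F G : ℝ → ℝ → E}, Measurable (Function.uncurry F) →
    Measurable (Function.uncurry G) → crossNorm a b F G ≤ K * diffNorm a b F * diffNorm a b G :=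
    fun hF hG => hK _ _ hF hG
  set S := Q₁ + Q₂ with hS
  calc diffNorm a b G ≤ M ^ 2 * sqNorm w +
        M ^ 2 * (2 * (∫⁻ h, sqNorm (diffFst h w) ∂(fracMeasure a)) + 4 * Ω ^ 2 *
        ((∫⁻ h, sqNorm (diffFst h F₁) ∂(fracMeasure a)) +
          ∫⁻ h, sqNorm (diffFst h F₂) ∂(fracMeasure a))) +
        M ^ 2 * (2 * (∫⁻ k, sqNorm (diffSnd k w) ∂(fracMeasure b)) + 4 * Ω ^ 2 *
        ((∫⁻ k, sqNorm (diffSnd k F₁) ∂(fracMeasure b)) +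
          ∫⁻ k, sqNorm (diffSnd k F₂) ∂(fracMeasure b))) +
        M ^ 2 * (5 * mixedNorm a b w + 10 * (K * q * Q₁) + 10 * (K * q * Q₂) +
        10 * (K * Q₁ * q) + 10 * (K * Q₂ * q) +
        250 * Ω ^ 2 * (mixedNorm a b F₁ + mixedNorm a b F₂) +
        20 * Ω ^ 2 * (K * Q₁ * Q₁ + K * Q₁ * Q₂ + K * Q₂ * Q₁ + K * Q₂ * Q₂)) := by
        rw [diffNorm_eq]
        refine add_le_add (add_le_add (add_le_add s0 s1) s2) (s3.trans ?_)
        gcongr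
        exacts [c mw hF₁, c mw hF₂, c hF₁ mw, c hF₂ mw, c hF₁ hF₁, c hF₁ hF₂, c hF₂ hF₁, c hF₂ hF₂]
    -- Coefficients are raised to the common values 5 and 250, and the missing L² terms of F₁ and F₂
    -- are added, so that whole difference norms can be reassembled.
    _ ≤ M ^ 2 * (5 * sqNorm w) +
        M ^ 2 * (5 * (∫⁻ h, sqNorm (diffFst h w) ∂(fracMeasure a)) + 250 * Ω ^ 2 *
        ((∫⁻ h, sqNorm (diffFst h F₁) ∂(fracMeasure a)) +
          ∫⁻ h, sqNorm (diffFst h F₂) ∂(fracMeasure a))) +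
        M ^ 2 * (5 * (∫⁻ k, sqNorm (diffSnd k w) ∂(fracMeasure b)) + 250 * Ω ^ 2 *
        ((∫⁻ k, sqNorm (diffSnd k F₁) ∂(fracMeasure b)) +
          ∫⁻ k, sqNorm (diffSnd k F₂) ∂(fracMeasure b))) +
        M ^ 2 * (5 * mixedNorm a b w + 10 * (K * q * Q₁) + 10 * (K * q * Q₂) +
        10 * (K * Q₁ * q) + 10 * (K * Q₂ * q) +
        250 * Ω ^ 2 * (mixedNorm a b F₁ + mixedNorm a b F₂) +
        20 * Ω ^ 2 * (K * Q₁ * Q₁ + K * Q₁ * Q₂ + K * Q₂ * Q₁ + K * Q₂ * Q₂)) +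
        M ^ 2 * 250 * Ω ^ 2 * (sqNorm F₁ + sqNorm F₂) := by
        refine le_add_right ?_
        gcongr
        · exact le_mul_of_one_le_left' (by norm_num)
        all_goals norm_num
    _ = M ^ 2 * (5 * q + 20 * K * q * S + 250 * Ω ^ 2 * S + 20 * K * Ω ^ 2 * S ^ 2) := by
        rw [hS, hQ₁, hQ₂, hq, diffNorm_eq a b w, diffNorm_eq a b F₁, diffNorm_eq a b F₂]
        ring
    -- The added terms complete the product (250 + 20K) M² (q + Ω²)(1 + S + S²).
    _ ≤ M ^ 2 * (5 * q + 20 * K * q * S + 250 * Ω ^ 2 * S + 20 * K * Ω ^ 2 * S ^ 2) +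
        M ^ 2 * (245 * q + 20 * K * q + 250 * q * S + (250 + 20 * K) * q * S ^ 2 +
          (250 + 20 * K) * Ω ^ 2 + 20 * K * Ω ^ 2 * S + 250 * Ω ^ 2 * S ^ 2) := le_self_add
    _ = _ := by push_cast; ring

end Nemytskii

/-! ### Plane waves, translations and Plancherel. -/

open Real Complex in
/-- The plane wave `ζ ↦ e^{2πi⟨ζ, v⟩}`. -/
noncomputable def planeWave (v ζ : Plane) : ℂ := Complex.exp (2 * π * I * (inner ℝ ζ v : ℝ))

theorem iteratedDeriv_cexp_const_mul_ofReal (c : ℂ) (n : ℕ) :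
    iteratedDeriv n (fun t : ℝ => Complex.exp (c * t)) = fun t : ℝ => c ^ n * Complex.exp (c * t) := by
  induction n with
  | zero => simp
  | succ n ih =>
    rw [iteratedDeriv_succ, ih]
    ext t
    have h1 : HasDerivAt (fun t : ℝ => c * (t : ℂ)) c t := by
      simpa using (Complex.ofRealCLM.hasDerivAt (x := t)).const_mul c
    rw [(h1.cexp.const_mul (c ^ n)).deriv]
    ring

theorem hasTemperateGrowth_cexp_ofReal {c : ℂ} (hc : c.re = 0) :
    Function.HasTemperateGrowth fun t : ℝ => Complex.exp (c * t) := by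
  refine ⟨(contDiff_const.mul Complex.ofRealCLM.contDiff).cexp, fun n => ⟨0, ‖c‖ ^ n, fun t => ?_⟩⟩
  rw [norm_iteratedFDeriv_eq_norm_iteratedDeriv, iteratedDeriv_cexp_const_mul_ofReal]
  simp [Complex.norm_exp, hc]

theorem hasTemperateGrowth_planeWave (v : Plane) : (planeWave v).HasTemperateGrowth := by
  have h1 := hasTemperateGrowth_cexp_ofReal (c := 2 * Real.pi * Complex.I) (by simp)
  exact h1.comp (Function.hasTemperateGrowth_inner_left v)

theorem norm_planeWave (v ζ : Plane) : ‖planeWave v ζ‖ = 1 := by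
  simp [planeWave, Complex.norm_exp]

theorem measurable_planeWave (v : Plane) : Measurable (planeWave v) :=
  (hasTemperateGrowth_planeWave v).1.continuous.measurable

/-- The translation rule, stated on test functions. Moving the shift x - v over to the tested
function gives f (x + v), whence the modulation in `IsFourierPair.comp_add`. -/
theorem fourier_planeWave_smul (v : Plane) (φ : 𝓢(Plane, ℂ)) (x : Plane) :
    𝓕 (SchwartzMap.smulLeftCLM ℂ (planeWave v) φ) x = 𝓕 φ (x - v) := by
  rw [SchwartzMap.fourier_coe, SchwartzMap.fourier_coe, Real.fourier_eq', Real.fourier_eq']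
  refine integral_congr_ae (.of_forall fun ζ => ?_)
  dsimp only
  rw [SchwartzMap.smulLeftCLM_apply_apply (hasTemperateGrowth_planeWave v), smul_smul, planeWave,
    ← Complex.exp_add]
  congr 2
  rw [inner_sub_right]
  push_cast
  ring

/-- `f` and `g` are square integrable and `g` is the Fourier transform of `f`. -/
structure IsFourierPair (f g : Plane → CPlane) : Prop where
  memLp_fst : MemLp f 2 volume
  memLp_snd : MemLp g 2 volume
  integral_eq : ∀ φ : 𝓢(Plane, ℂ), ∫ x, 𝓕 φ x • f x = ∫ ζ, φ ζ • g ζ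

theorem integrable_schwartz_smul {f : Plane → CPlane} (hf : MemLp f 2 volume)
    (φ : 𝓢(Plane, ℂ)) : Integrable (fun x => φ x • f x) volume :=
  memLp_one_iff_integrable.1 (hf.smul (φ.memLp 2 volume))

theorem toTemperedDistribution_toLp_apply {f : Plane → CPlane} (hf : MemLp f 2 volume)
    (φ : 𝓢(Plane, ℂ)) :
    Lp.toTemperedDistribution (hf.toLp f) φ = ∫ x, φ x • f x := by
  rw [Lp.toTemperedDistribution_apply]
  refine integral_congr_ae ?_
  filter_upwards [hf.coeFn_toLp] with x hx
  rw [hx]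

theorem toTemperedDistribution_injective : Function.Injective
    (Lp.toTemperedDistribution : Lp CPlane 2 (volume : Measure Plane) → 𝓢'(Plane, CPlane)) := by
  have := LinearMap.ker_eq_bot.1
    (Lp.ker_toTemperedDistributionCLM_eq_bot (F := CPlane) (μ := (volume : Measure Plane)) (p := 2))
  exact this

/-- L² embeds injectively in the tempered distributions, so testing on Schwartz functions identifies
the L² Fourier transform, and Plancherel becomes available. -/
theorem IsFourierPair.fourier_toLp {f g : Plane → CPlane} (h : IsFourierPair f g) :
    𝓕 (h.memLp_fst.toLp f) = h.memLp_snd.toLp g := by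
  apply toTemperedDistribution_injective
  rw [← Lp.fourier_toTemperedDistribution_eq]
  ext1 φ
  rw [TemperedDistribution.fourier_apply, toTemperedDistribution_toLp_apply,
    toTemperedDistribution_toLp_apply]
  exact h.integral_eq φ

theorem eLpNorm_two_sq_eq {α F : Type*} [MeasurableSpace α] [NormedAddCommGroup F] (f : α → F)
    (μ : Measure α) : eLpNorm f 2 μ ^ 2 = ∫⁻ x, ‖f x‖ₑ ^ 2 ∂μ := by
  rw [eLpNorm_eq_lintegral_rpow_enorm_toReal (by norm_num) (by norm_num)]
  simp only [ENNReal.toReal_ofNat]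
  rw [← ENNReal.rpow_natCast, ← ENNReal.rpow_mul]
  norm_num

/-- Plancherel's theorem. -/
theorem IsFourierPair.lintegral_eq {f g : Plane → CPlane} (h : IsFourierPair f g) :
    ∫⁻ x, ‖f x‖ₑ ^ 2 = ∫⁻ ζ, ‖g ζ‖ₑ ^ 2 := by
  have h1 := Lp.norm_fourier_eq (h.memLp_fst.toLp f)
  rw [h.fourier_toLp, Lp.norm_toLp, Lp.norm_toLp,
    ENNReal.toReal_eq_toReal_iff' h.memLp_snd.2.ne h.memLp_fst.2.ne] at h1
  rw [← eLpNorm_two_sq_eq, ← eLpNorm_two_sq_eq, h1]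

theorem IsFourierPair.comp_add {f g : Plane → CPlane} (h : IsFourierPair f g) (v : Plane) :
    IsFourierPair (fun x => f (x + v)) (fun ζ => planeWave v ζ • g ζ) where
  memLp_fst := h.memLp_fst.comp_measurePreserving (measurePreserving_add_right volume v)
  memLp_snd := by
    refine h.memLp_snd.of_le ((measurable_planeWave v).aestronglyMeasurable.smul
      h.memLp_snd.1) (.of_forall fun ζ => ?_)
    rw [norm_smul, norm_planeWave, one_mul]
  integral_eq φ := by
    have h1 : ∫ x, 𝓕 φ x • f (x + v) = ∫ x, 𝓕 φ (x - v) • f x := by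
      rw [← integral_add_right_eq_self (fun x => 𝓕 φ (x - v) • f x) v]
      simp
    rw [h1]
    simp_rw [← fourier_planeWave_smul]
    rw [h.integral_eq]
    refine integral_congr_ae (.of_forall fun ζ => ?_)
    dsimp only
    rw [SchwartzMap.smulLeftCLM_apply_apply (hasTemperateGrowth_planeWave v), smul_smul,
      smul_eq_mul, mul_comm]

theorem IsFourierPair.sub {f₁ g₁ f₂ g₂ : Plane → CPlane} (h₁ : IsFourierPair f₁ g₁)
    (h₂ : IsFourierPair f₂ g₂) :
    IsFourierPair (fun x => f₁ x - f₂ x) (fun ζ => g₁ ζ - g₂ ζ) where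
  memLp_fst := h₁.memLp_fst.sub h₂.memLp_fst
  memLp_snd := h₁.memLp_snd.sub h₂.memLp_snd
  integral_eq φ := by
    simp_rw [smul_sub]
    rw [integral_sub (integrable_schwartz_smul h₁.memLp_fst _)
        (integrable_schwartz_smul h₂.memLp_fst _),
      integral_sub (integrable_schwartz_smul h₁.memLp_snd _)
        (integrable_schwartz_smul h₂.memLp_snd _), h₁.integral_eq, h₂.integral_eq]

theorem IsFourierPair.diff {f g : Plane → CPlane} (h : IsFourierPair f g) (v : Plane) :
    IsFourierPair (fun x => f (x + v) - f x) (fun ζ => (planeWave v ζ - 1) • g ζ) := by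
  simpa only [sub_smul, one_smul] using (h.comp_add v).sub h

/-! ### The Fourier symbol of the difference norm. -/

/-- The squared modulus of the symbol of the difference operator with step one. -/
noncomputable def diffSymbol (t : ℝ) : ℝ≥0∞ := ‖Complex.exp (2 * Real.pi * Complex.I * t) - 1‖ₑ ^ 2

theorem measurable_diffSymbol : Measurable diffSymbol := by
  unfold diffSymbol; fun_prop

/-- The Fourier symbol of the difference quotient norm of order `a`. -/
noncomputable def fracSymbol (a t : ℝ) : ℝ≥0∞ := ∫⁻ h, diffSymbol (h * t) ∂(fracMeasure a)

theorem measurable_fracSymbol (a : ℝ) : Measurable (fracSymbol a) := by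
  refine Measurable.lintegral_prod_right' (f := fun p : ℝ × ℝ => diffSymbol (p.2 * p.1)) ?_
  exact measurable_diffSymbol.comp (by fun_prop)

theorem lintegral_plane {φ : Plane → ℝ≥0∞} (hφ : Measurable φ) :
    ∫⁻ z, φ z = ∫⁻ x : ℝ, ∫⁻ y : ℝ, φ !₂[x, y] := by
  rw [← (PiLp.volume_preserving_toLp (Fin 2)).lintegral_comp hφ,
    ← ((volume_preserving_finTwoArrow ℝ).symm _).lintegral_comp (by fun_prop),
    Measure.volume_eq_prod, lintegral_prod _ (by fun_prop)]
  rfl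

theorem measurable_uncurry_of_plane {E : Type*} [MeasurableSpace E] {f : Plane → E}
    (hf : Measurable f) : Measurable (Function.uncurry fun x y : ℝ => f !₂[x, y]) := by
  refine hf.comp (?_ : Measurable fun p : ℝ × ℝ => !₂[p.1, p.2])
  have : Measurable fun p : ℝ × ℝ => ![p.1, p.2] := by
    rw [measurable_pi_iff]; intro i; fin_cases i <;> simp <;> fun_prop
  exact (by fun_prop : Measurable (WithLp.toLp 2 : (Fin 2 → ℝ) → Plane)).comp this

theorem IsFourierPair.sqNorm_eq {f g : Plane → CPlane} (h : IsFourierPair f g)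
    (hf : Measurable f) : sqNorm (fun x y => f !₂[x, y]) = ∫⁻ ζ, ‖g ζ‖ₑ ^ 2 := by
  rw [← h.lintegral_eq, lintegral_plane (by fun_prop)]
  rfl

theorem diffFst_plane (f : Plane → CPlane) (h : ℝ) :
    diffFst h (fun x y => f !₂[x, y]) =
      fun x y => (fun z => f (z + !₂[h, 0]) - f z) !₂[x, y] := by
  ext1 x; ext1 y
  simp only [diffFst]
  congr 2
  ext i; fin_cases i <;> simp

theorem diffSnd_plane (f : Plane → CPlane) (k : ℝ) :
    diffSnd k (fun x y => f !₂[x, y]) =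
      fun x y => (fun z => f (z + !₂[0, k]) - f z) !₂[x, y] := by
  ext1 x; ext1 y
  simp only [diffSnd]
  congr 2
  ext i; fin_cases i <;> simp

theorem enorm_planeWave_fst_sub_one (h : ℝ) (ζ : Plane) :
    ‖planeWave !₂[h, 0] ζ - 1‖ₑ ^ 2 = diffSymbol (h * ζ 0) := by
  simp [planeWave, diffSymbol, PiLp.inner_apply, Fin.sum_univ_two]

theorem enorm_planeWave_snd_sub_one (k : ℝ) (ζ : Plane) :
    ‖planeWave !₂[0, k] ζ - 1‖ₑ ^ 2 = diffSymbol (k * ζ 1) := by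
  simp [planeWave, diffSymbol, PiLp.inner_apply, Fin.sum_univ_two]

theorem IsFourierPair.sqNorm_diffFst_eq {f g : Plane → CPlane} (H : IsFourierPair f g)
    (hf : Measurable f) (h : ℝ) : sqNorm (diffFst h (fun x y => f !₂[x, y])) =
      ∫⁻ ζ, diffSymbol (h * ζ 0) * ‖g ζ‖ₑ ^ 2 := by
  rw [diffFst_plane, (H.diff !₂[h, 0]).sqNorm_eq (by fun_prop)]
  simp_rw [enorm_smul, mul_pow, enorm_planeWave_fst_sub_one]

theorem IsFourierPair.sqNorm_diffSnd_eq {f g : Plane → CPlane} (H : IsFourierPair f g)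
    (hf : Measurable f) (k : ℝ) : sqNorm (diffSnd k (fun x y => f !₂[x, y])) =
      ∫⁻ ζ, diffSymbol (k * ζ 1) * ‖g ζ‖ₑ ^ 2 := by
  rw [diffSnd_plane, (H.diff !₂[0, k]).sqNorm_eq (by fun_prop)]
  simp_rw [enorm_smul, mul_pow, enorm_planeWave_snd_sub_one]

theorem IsFourierPair.sqNorm_diffFst_diffSnd_eq {f g : Plane → CPlane} (H : IsFourierPair f g)
    (hf : Measurable f) (h k : ℝ) : sqNorm (diffFst h (diffSnd k (fun x y => f !₂[x, y]))) =
      ∫⁻ ζ, diffSymbol (h * ζ 0) * (diffSymbol (k * ζ 1) * ‖g ζ‖ₑ ^ 2) := by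
  rw [diffSnd_plane, (H.diff !₂[0, k]).sqNorm_diffFst_eq (by fun_prop)]
  simp_rw [enorm_smul, mul_pow, enorm_planeWave_snd_sub_one]

theorem lintegral_fracMeasure_symbol (a : ℝ) (i : Fin 2) {ψ : Plane → ℝ≥0∞} (hψ : Measurable ψ) :
    ∫⁻ h, (∫⁻ ζ : Plane, diffSymbol (h * ζ i) * ψ ζ) ∂(fracMeasure a) =
      ∫⁻ ζ : Plane, fracSymbol a (ζ i) * ψ ζ := by
  have m : Measurable fun p : ℝ × Plane => diffSymbol (p.1 * p.2 i) * ψ p.2 :=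
    (measurable_diffSymbol.comp (by fun_prop)).mul (hψ.comp measurable_snd)
  rw [lintegral_lintegral_swap (f := fun h (ζ : Plane) => diffSymbol (h * ζ i) * ψ ζ)
    m.aemeasurable]
  refine lintegral_congr fun ζ => ?_
  exact lintegral_mul_const _ (measurable_diffSymbol.comp (by fun_prop : Measurable (· * ζ i)))

/-- Plancherel makes each difference a multiplier in τ or ξ, and Tonelli integrates out the steps.
The four summands are the expansion of the product of the two one-variable symbols. -/
theorem IsFourierPair.diffNorm_eq {f g : Plane → CPlane} (H : IsFourierPair f g)
    (hf : Measurable f) (hg : Measurable g) (a b : ℝ) :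
    diffNorm a b (fun x y => f !₂[x, y]) =
      ∫⁻ ζ : Plane, (1 + fracSymbol a (ζ 0)) * (1 + fracSymbol b (ζ 1)) * ‖g ζ‖ₑ ^ 2 := by
  have mg : Measurable fun ζ => ‖g ζ‖ₑ ^ 2 := by fun_prop
  have ma : Measurable fun ζ : Plane => fracSymbol a (ζ 0) :=
    (measurable_fracSymbol a).comp (by fun_prop)
  have mb : Measurable fun ζ : Plane => fracSymbol b (ζ 1) :=
    (measurable_fracSymbol b).comp (by fun_prop)
  have mbg : Measurable fun ζ : Plane => fracSymbol b (ζ 1) * ‖g ζ‖ₑ ^ 2 := mb.mul mg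
  have mabg : Measurable fun ζ : Plane => fracSymbol a (ζ 0) * (fracSymbol b (ζ 1) * ‖g ζ‖ₑ ^ 2) :=
    ma.mul mbg
  have hmix : ∀ h, ∫⁻ k, (∫⁻ ζ : Plane, diffSymbol (h * ζ 0) * (diffSymbol (k * ζ 1) * ‖g ζ‖ₑ ^ 2))
      ∂(fracMeasure b) = ∫⁻ ζ : Plane, diffSymbol (h * ζ 0) * (fracSymbol b (ζ 1) * ‖g ζ‖ₑ ^ 2) := by
    intro h
    have m0 : Measurable fun ζ : Plane => diffSymbol (h * ζ 0) * ‖g ζ‖ₑ ^ 2 :=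
      (measurable_diffSymbol.comp (by fun_prop)).mul mg
    have := lintegral_fracMeasure_symbol b 1 m0
    simp only [mul_left_comm (diffSymbol (h * _))]
    exact this
  rw [diffNorm, H.sqNorm_eq hf]
  simp_rw [H.sqNorm_diffFst_eq hf, H.sqNorm_diffSnd_eq hf, H.sqNorm_diffFst_diffSnd_eq hf, hmix]
  rw [lintegral_fracMeasure_symbol a 0 mg, lintegral_fracMeasure_symbol b 1 mg,
    lintegral_fracMeasure_symbol a 0 mbg, ← lintegral_add_left mg,
    ← lintegral_add_right _ mbg, ← lintegral_add_right _ mabg]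
  refine lintegral_congr fun ζ => ?_
  ring

theorem norm_cexp_sub_one_le_two (t : ℝ) :
    ‖Complex.exp (2 * Real.pi * Complex.I * t) - 1‖ ≤ 2 := by
  refine (norm_sub_le _ _).trans ?_
  rw [Complex.norm_exp]
  simp
  norm_num

theorem norm_cexp_sub_one_le (t : ℝ) :
    ‖Complex.exp (2 * Real.pi * Complex.I * t) - 1‖ ≤ 2 * Real.pi * |t| := by
  have := Real.norm_exp_I_mul_ofReal_sub_one_le (x := 2 * Real.pi * t)
  rw [show Complex.I * ((2 * Real.pi * t : ℝ) : ℂ) = 2 * Real.pi * Complex.I * t by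
    push_cast; ring] at this
  refine this.trans (le_of_eq ?_)
  rw [Real.norm_eq_abs, abs_mul, abs_of_pos (by positivity)]

theorem fracSymbol_eq_lintegral (a t : ℝ) : fracSymbol a t =
    ∫⁻ h, ENNReal.ofReal (|h| ^ (-(1 + 2 * a))) * diffSymbol (h * t) :=
  lintegral_fracMeasure a (measurable_diffSymbol.comp (by fun_prop : Measurable (· * t)))

/-- The radial majorant of the integrand of the symbol. -/
noncomputable def symbolMajorant (a y : ℝ) : ℝ :=
  if y ≤ 1 then (2 * Real.pi) ^ 2 * y ^ (1 - 2 * a) else 4 * y ^ (-(1 + 2 * a))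

/-- Near 0 the exponent 1 - 2a exceeds -1 because a < 1; at infinity the exponent -(1 + 2a) is below
-1 because a > 0. -/
theorem integrable_symbolMajorant {a : ℝ} (ha : 0 < a) (ha1 : a < 1) :
    Integrable (fun h : ℝ => symbolMajorant a ‖h‖) := by
  rw [integrable_fun_norm_addHaar volume]
  simp only [Module.finrank_self, Nat.sub_self, pow_zero, one_smul]
  rw [← Set.Ioc_union_Ioi_eq_Ioi (zero_le_one' ℝ)]
  refine IntegrableOn.union ?_ ?_
  · have h1 : IntegrableOn (fun y : ℝ => (2 * Real.pi) ^ 2 * y ^ (1 - 2 * a)) (Set.Ioc 0 1) := by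
      refine Integrable.const_mul ?_ _
      exact (intervalIntegrable_iff_integrableOn_Ioc_of_le zero_le_one).1
        (intervalIntegral.intervalIntegrable_rpow' (by linarith))
    refine h1.congr_fun (fun y hy => ?_) measurableSet_Ioc
    simp [symbolMajorant, hy.2]
  · have h1 : IntegrableOn (fun y : ℝ => 4 * y ^ (-(1 + 2 * a))) (Set.Ioi 1) := by
      refine Integrable.const_mul ?_ _
      exact integrableOn_Ioi_rpow_of_lt (by linarith) one_pos
    refine h1.congr_fun (fun y hy => ?_) measurableSet_Ioi
    simp [symbolMajorant, not_le.2 (Set.mem_Ioi.1 hy)]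

theorem fracSymbol_one_lt_top {a : ℝ} (ha : 0 < a) (ha1 : a < 1) : fracSymbol a 1 < ∞ := by
  rw [fracSymbol_eq_lintegral]
  refine lt_of_le_of_lt ?_ (integrable_symbolMajorant ha ha1).lintegral_lt_top
  have h0 : ∀ᵐ h : ℝ, h ≠ 0 := by simp [ae_iff]
  refine lintegral_mono_ae ?_
  filter_upwards [h0] with h hh
  have hh' : 0 < |h| := abs_pos.2 hh
  rw [mul_one, diffSymbol, ← ofReal_norm, ← ENNReal.ofReal_pow (norm_nonneg _),
    ← ENNReal.ofReal_mul (by positivity)]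
  refine ENNReal.ofReal_le_ofReal ?_
  rw [symbolMajorant, Real.norm_eq_abs]
  split_ifs with h1
  · calc _ ≤ |h| ^ (-(1 + 2 * a)) * (2 * Real.pi * |h|) ^ 2 := by
          gcongr
          exact norm_cexp_sub_one_le h
      _ = (2 * Real.pi) ^ 2 * (|h| ^ (-(1 + 2 * a)) * |h| ^ (2 : ℕ)) := by ring
      _ = _ := by
          rw [← Real.rpow_natCast |h| 2, ← Real.rpow_add hh']
          congr 2
          push_cast; ring
  · calc _ ≤ |h| ^ (-(1 + 2 * a)) * 2 ^ 2 := by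
          gcongr
          exact norm_cexp_sub_one_le_two h
      _ = _ := by ring

/-- The integrand is nonzero on (0, 1), since e^{2πih} = 1 only for integral h. -/
theorem fracSymbol_one_pos (a : ℝ) : 0 < fracSymbol a 1 := by
  have hm : Measurable fun h : ℝ => ENNReal.ofReal (|h| ^ (-(1 + 2 * a))) * diffSymbol (h * 1) :=
    (measurable_fracWeight a).mul (measurable_diffSymbol.comp (by fun_prop : Measurable (· * (1 : ℝ))))
  rw [fracSymbol_eq_lintegral,
    lintegral_pos_iff_support hm]
  refine lt_of_lt_of_le ?_ (measure_mono (s := Set.Ioo 0 1) fun h hh => ?_)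
  · simp
  · have hh' : 0 < |h| := abs_pos.2 hh.1.ne'
    rw [Function.mem_support, mul_one]
    refine mul_ne_zero ?_ ?_
    · simpa using Real.rpow_pos_of_pos hh' _
    · rw [diffSymbol]
      refine pow_ne_zero _ ?_
      rw [enorm_ne_zero, sub_ne_zero, ne_eq, Complex.exp_eq_one_iff]
      rintro ⟨n, hn⟩
      have h2 : (h : ℂ) = n := by
        have : (2 * Real.pi * Complex.I : ℂ) ≠ 0 := Complex.two_pi_I_ne_zero
        apply mul_left_cancel₀ this
        rw [hn]; ring
      have h3 : h = (n : ℝ) := by exact_mod_cast h2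
      have h4 := hh.1
      have h5 := hh.2
      rw [h3] at h4 h5
      have h6 : 0 < n := by exact_mod_cast h4
      have h7 : n < 1 := by exact_mod_cast h5
      omega

/-- Homogeneity: the substitution h ↦ th in the integral for t = 1 produces the factor |t| ·
|t|^{-(1+2a)} = |t|^{-2a}. -/
theorem fracSymbol_eq {a : ℝ} (ha : 0 < a) (t : ℝ) :
    fracSymbol a t = ENNReal.ofReal (|t| ^ (2 * a)) * fracSymbol a 1 := by
  rcases eq_or_ne t 0 with rfl | ht
  · rw [abs_zero, Real.zero_rpow (by positivity)]
    simp [fracSymbol, diffSymbol]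
  have ht' : 0 < |t| := abs_pos.2 ht
  set φ : ℝ → ℝ≥0∞ := fun h => ENNReal.ofReal (|h| ^ (-(1 + 2 * a))) * diffSymbol h with hφ
  have mφ : Measurable φ := (measurable_fracWeight a).mul measurable_diffSymbol
  have h1 : fracSymbol a 1 = ENNReal.ofReal |t| * ∫⁻ h, φ (t * h) := by
    rw [fracSymbol_eq_lintegral]
    simp only [mul_one]
    conv_lhs => rw [← Real.smul_map_volume_mul_left ht]
    rw [lintegral_smul_measure, lintegral_map mφ (by fun_prop), smul_eq_mul]
  have h2 : ∀ h, φ (t * h) = ENNReal.ofReal (|t| ^ (-(1 + 2 * a))) *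
      (ENNReal.ofReal (|h| ^ (-(1 + 2 * a))) * diffSymbol (h * t)) := by
    intro h
    simp only [hφ]
    rw [abs_mul, Real.mul_rpow (abs_nonneg _) (abs_nonneg _), ENNReal.ofReal_mul (by positivity),
      mul_assoc, mul_comm t h]
  simp_rw [h2] at h1
  rw [lintegral_const_mul' _ _ (by finiteness), ← fracSymbol_eq_lintegral, ← mul_assoc,
    ← ENNReal.ofReal_mul (by positivity)] at h1
  rw [h1, ← mul_assoc, ← ENNReal.ofReal_mul (by positivity)]
  have : |t| ^ (2 * a) * (|t| * |t| ^ (-(1 + 2 * a))) = 1 := by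
    nth_rw 2 [← Real.rpow_one |t|]
    rw [← Real.rpow_add ht', ← Real.rpow_add ht', ← Real.rpow_zero |t|]
    congr 1; ring
  rw [this, ENNReal.ofReal_one, one_mul]

theorem japaneseBracket_rpow (a t : ℝ) : japaneseBracket t ^ (2 * a) = (1 + |t| ^ 2) ^ a := by
  rw [japaneseBracket, Real.sqrt_eq_rpow, ← Real.rpow_mul (by positivity)]
  congr 1; ring

/-- The symbol of the difference quotient norm is comparable with `⟨t⟩^{2a}`. -/
theorem exists_fracSymbol_bounds {a : ℝ} (ha : 0 < a) (ha1 : a < 1) : ∃ C : ℝ≥0, ∀ t,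
    ENNReal.ofReal (japaneseBracket t ^ (2 * a)) ≤ C * (1 + fracSymbol a t) ∧
      1 + fracSymbol a t ≤ C * ENNReal.ofReal (japaneseBracket t ^ (2 * a)) := by
  obtain ⟨κ, hκ⟩ : ∃ κ : ℝ≥0, (κ : ℝ≥0∞) = fracSymbol a 1 :=
    ⟨_, ENNReal.coe_toNNReal (fracSymbol_one_lt_top ha ha1).ne⟩
  have hκ0 : 0 < κ := by
    have := fracSymbol_one_pos a
    rw [← hκ] at this
    exact_mod_cast this
  refine ⟨1 + κ⁻¹ + κ, fun t => ?_⟩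
  have e : 1 + fracSymbol a t = ENNReal.ofReal (1 + |t| ^ (2 * a) * κ) := by
    rw [fracSymbol_eq ha, ← hκ, ENNReal.ofReal_add zero_le_one (by positivity),
      ENNReal.ofReal_mul (by positivity), ENNReal.ofReal_one, ENNReal.ofReal_coe_nnreal]
  have e2 : |t| ^ (2 * a) = (|t| ^ 2) ^ a := by
    rw [← Real.rpow_natCast, ← Real.rpow_mul (abs_nonneg _)]; norm_num
  have ec : ((1 + κ⁻¹ + κ : ℝ≥0) : ℝ≥0∞) = ENNReal.ofReal (1 + (κ : ℝ)⁻¹ + κ) := by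
    rw [← ENNReal.ofReal_coe_nnreal]; push_cast; rfl
  have hκ0' : (0 : ℝ) < κ := hκ0
  set J := (1 + |t| ^ 2) ^ a with hJ
  set P := (|t| ^ 2) ^ a with hP
  have hP0 : 0 ≤ P := by positivity
  -- Subadditivity of x ↦ x^a, where a ≤ 1 is used.
  have hJ1 : J ≤ 1 + P := by
    have := Real.rpow_add_le_add_rpow (p := a) zero_le_one (sq_nonneg |t|) ha.le ha1.le
    rwa [Real.one_rpow] at this
  have hJ2 : 1 ≤ J := Real.one_le_rpow (by nlinarith [sq_nonneg |t|]) ha.le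
  have hJ3 : P ≤ J := Real.rpow_le_rpow (sq_nonneg _) (by linarith) ha.le
  have hκi : (κ : ℝ)⁻¹ * κ = 1 := inv_mul_cancel₀ hκ0'.ne'
  have hκi0 : 0 < (κ : ℝ)⁻¹ := inv_pos.2 hκ0'
  rw [e, e2, ec, japaneseBracket_rpow, ← ENNReal.ofReal_mul (by positivity),
    ← ENNReal.ofReal_mul (by positivity)]
  constructor <;> apply ENNReal.ofReal_le_ofReal
  · nlinarith [mul_nonneg hP0 hκ0'.le, mul_nonneg (mul_nonneg hP0 hκ0'.le) hκ0'.le]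
  · nlinarith [mul_le_mul_of_nonneg_right hJ3 hκ0'.le, mul_pos hκi0 (lt_of_lt_of_le one_pos hJ2)]

/-- The weight of `H_α^a H_β^b`. -/
noncomputable def prodWeight (a b : ℝ) (ζ : Plane) : ℝ≥0∞ :=
  ENNReal.ofReal (japaneseBracket (ζ 0) ^ (2 * a) * japaneseBracket (ζ 1) ^ (2 * b))

theorem exists_prodWeight_bounds {a b : ℝ} (ha : 0 < a) (ha1 : a < 1) (hb : 0 < b) (hb1 : b < 1) :
    ∃ C : ℝ≥0, ∀ ζ : Plane,
      prodWeight a b ζ ≤ C * ((1 + fracSymbol a (ζ 0)) * (1 + fracSymbol b (ζ 1))) ∧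
      (1 + fracSymbol a (ζ 0)) * (1 + fracSymbol b (ζ 1)) ≤ C * prodWeight a b ζ := by
  obtain ⟨C₁, h₁⟩ := exists_fracSymbol_bounds ha ha1
  obtain ⟨C₂, h₂⟩ := exists_fracSymbol_bounds hb hb1
  refine ⟨C₁ * C₂, fun ζ => ?_⟩
  have e : prodWeight a b ζ = ENNReal.ofReal (japaneseBracket (ζ 0) ^ (2 * a)) *
      ENNReal.ofReal (japaneseBracket (ζ 1) ^ (2 * b)) := by
    rw [prodWeight, ENNReal.ofReal_mul (by unfold japaneseBracket; positivity)]
  rw [e, ENNReal.coe_mul]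
  constructor
  · exact (mul_le_mul' (h₁ _).1 (h₂ _).1).trans (le_of_eq (by ring))
  · exact (mul_le_mul' (h₁ _).2 (h₂ _).2).trans (le_of_eq (by ring))

/-! ### Passing between real and complex targets. -/

section Isometry

theorem diffNorm_map {E E' : Type*} [NormedAddCommGroup E] [NormedAddCommGroup E'] (L : E →+ E')
    (hL : ∀ x, ‖L x‖ = ‖x‖) (a b : ℝ) (F : ℝ → ℝ → E) :
    diffNorm a b (fun x y => L (F x y)) = diffNorm a b F := by
  have hL' : ∀ x, ‖L x‖ₑ = ‖x‖ₑ := fun x => by rw [← ofReal_norm, hL, ofReal_norm]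
  simp only [diffNorm, sqNorm, diffFst, diffSnd, ← map_sub, hL']

theorem diffNorm_sub_comm {E : Type*} [NormedAddCommGroup E] (a b : ℝ) (F G : ℝ → ℝ → E) :
    diffNorm a b (fun x y => F x y - G x y) = diffNorm a b (fun x y => G x y - F x y) := by
  rw [← diffNorm_map (-AddMonoidHom.id E) (by simp) a b fun x y => G x y - F x y]
  simp

/-- The inclusion `ℝ² ⊆ ℂ²` as an additive map. -/
noncomputable def toCPlaneHom : Plane →+ CPlane where
  toFun := toCPlane
  map_zero' := by ext i; simp [toCPlane]
  map_add' v w := by ext i; simp [toCPlane]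

theorem norm_toCPlane (v : Plane) : ‖toCPlane v‖ = ‖v‖ := by
  simp [toCPlane, EuclideanSpace.norm_eq]

theorem toCPlane_sub (v w : Plane) : toCPlane (v - w) = toCPlane v - toCPlane w :=
  map_sub toCPlaneHom v w

theorem continuous_toCPlane : Continuous toCPlane :=
  (AddMonoidHomClass.isometry_of_norm toCPlaneHom norm_toCPlane).continuous

theorem diffNorm_toCPlane (a b : ℝ) (F : ℝ → ℝ → Plane) :
    diffNorm a b (fun x y => toCPlane (F x y)) = diffNorm a b F :=
  diffNorm_map toCPlaneHom norm_toCPlane a b F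

end Isometry

/-! ### Distributions given by functions, and equivalence of the two norms. -/

section Distributions

theorem IsGivenBy.congr {T : 𝓢'(Plane, CPlane)} {g g' : Plane → CPlane} (h : IsGivenBy T g)
    (hg : g =ᵐ[volume] g') : IsGivenBy T g' := by
  refine ⟨h.1.congr hg, fun φ => ?_⟩
  have e : (fun x => φ x • g x) =ᵐ[volume] fun x => φ x • g' x := by
    filter_upwards [hg] with x hx
    rw [hx]
  exact ⟨(h.2 φ).1.congr e, (h.2 φ).2.trans (integral_congr_ae e)⟩

theorem IsGivenBy.sub {T T' : 𝓢'(Plane, CPlane)} {g g' : Plane → CPlane} (h : IsGivenBy T g)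
    (h' : IsGivenBy T' g') : IsGivenBy (T - T') (fun x => g x - g' x) := by
  refine ⟨h.1.sub h'.1, fun φ => ?_⟩
  simp_rw [smul_sub]
  refine ⟨(h.2 φ).1.sub (h'.2 φ).1, ?_⟩
  rw [integral_sub (h.2 φ).1 (h'.2 φ).1, ← (h.2 φ).2, ← (h'.2 φ).2]
  rfl

theorem isGivenBy_of_memLp_two {f : Plane → CPlane} (hf : MemLp f 2 volume) :
    IsGivenBy (Lp.toTemperedDistribution (hf.toLp f)) f :=
  ⟨hf.1, fun φ => ⟨integrable_schwartz_smul hf φ, toTemperedDistribution_toLp_apply hf φ⟩⟩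

/-- Needed for compositions with σ 0 ≠ 0, which are bounded but need not be square integrable. -/
theorem isGivenBy_of_memLp_top {f : Plane → CPlane} (hf : MemLp f ∞ volume) :
    IsGivenBy (Lp.toTemperedDistribution (hf.toLp f)) f := by
  refine ⟨hf.1, fun φ => ⟨memLp_one_iff_integrable.1 (hf.smul (φ.memLp 1 volume)), ?_⟩⟩
  rw [Lp.toTemperedDistribution_apply]
  refine integral_congr_ae ?_
  filter_upwards [hf.coeFn_toLp] with x hx
  rw [hx]

theorem IsGivenBy.eq_toTemperedDistribution {T : 𝓢'(Plane, CPlane)} {f : Plane → CPlane}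
    (h : IsGivenBy T f) (hf : MemLp f 2 volume) :
    T = Lp.toTemperedDistribution (hf.toLp f) := by
  ext1 φ
  rw [(h.2 φ).2, toTemperedDistribution_toLp_apply]

theorem IsGivenBy.isFourierPair {T : 𝓢'(Plane, CPlane)} {f g : Plane → CPlane}
    (h : IsGivenBy T f) (hf : MemLp f 2 volume) (h' : IsGivenBy (𝓕 T) g)
    (hg : MemLp g 2 volume) : IsFourierPair f g where
  memLp_fst := hf
  memLp_snd := hg
  integral_eq φ := by
    rw [← (h.2 _).2, ← (h'.2 _).2, TemperedDistribution.fourier_apply]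

theorem exists_isGivenBy_fourier {T : 𝓢'(Plane, CPlane)} {f : Plane → CPlane}
    (h : IsGivenBy T f) (hf : MemLp f 2 volume) :
    ∃ g : Plane → CPlane, Measurable g ∧ MemLp g 2 volume ∧ IsGivenBy (𝓕 T) g := by
  set G : Lp CPlane 2 (volume : Measure Plane) := 𝓕 (hf.toLp f)
  refine ⟨G, (Lp.stronglyMeasurable G).measurable, Lp.memLp G, ?_⟩
  rw [h.eq_toTemperedDistribution hf, Lp.fourier_toTemperedDistribution_eq]
  exact ⟨Lp.aestronglyMeasurable G, fun φ => ⟨integrable_schwartz_smul (Lp.memLp G) φ,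
    Lp.toTemperedDistribution_apply _ _⟩⟩

theorem exists_isGivenBy_of_fourier {T : 𝓢'(Plane, CPlane)} {g : Plane → CPlane}
    (h : IsGivenBy (𝓕 T) g) (hg : MemLp g 2 volume) :
    ∃ f : Plane → CPlane, Measurable f ∧ MemLp f 2 volume ∧ IsGivenBy T f := by
  set G : Lp CPlane 2 (volume : Measure Plane) := FourierTransformInv.fourierInv (hg.toLp g)
  refine ⟨G, (Lp.stronglyMeasurable G).measurable, Lp.memLp G, ?_⟩
  have hT : T = FourierTransformInv.fourierInv (𝓕 T) :=
    (FourierTransform.fourierInv_fourier_eq T).symm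
  rw [hT, h.eq_toTemperedDistribution hg, Lp.fourierInv_toTemperedDistribution_eq]
  exact ⟨Lp.aestronglyMeasurable G, fun φ => ⟨integrable_schwartz_smul (Lp.memLp G) φ,
    Lp.toTemperedDistribution_apply _ _⟩⟩

theorem one_le_prodWeight {a b : ℝ} (ha : 0 ≤ a) (hb : 0 ≤ b) (ζ : Plane) :
    1 ≤ prodWeight a b ζ := by
  have h : ∀ {c : ℝ}, 0 ≤ c → ∀ t, 1 ≤ japaneseBracket t ^ (2 * c) := fun hc t => by
    rw [japaneseBracket_rpow]
    exact Real.one_le_rpow (by nlinarith [sq_nonneg |t|]) hc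
  rw [prodWeight, ENNReal.one_le_ofReal]
  exact one_le_mul_of_one_le_of_one_le (h ha _) (h hb _)

theorem memLp_two_of_weight {a b : ℝ} (ha : 0 ≤ a) (hb : 0 ≤ b) {g : Plane → CPlane}
    (hg : AEStronglyMeasurable g volume)
    (h : ∫⁻ ζ, prodWeight a b ζ * ‖g ζ‖ₑ ^ 2 < ∞) : MemLp g 2 volume := by
  refine ⟨hg, ?_⟩
  have h1 : eLpNorm g 2 volume ^ 2 < ∞ := by
    rw [eLpNorm_two_sq_eq]
    refine lt_of_le_of_lt (lintegral_mono fun ζ => ?_) h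
    exact le_mul_of_one_le_left' (one_le_prodWeight ha hb ζ)
  exact lt_top_iff_ne_top.2 fun h2 => by simp [h2] at h1

theorem prodNorm_eq (a b : ℝ) (T : 𝓢'(Plane, CPlane)) :
    prodNorm a b T = ⨅ (g : Plane → CPlane) (_ : IsGivenBy (𝓕 T) g),
      (∫⁻ ζ : Plane, prodWeight a b ζ * ‖g ζ‖ₑ ^ 2) ^ (1 / 2 : ℝ) := rfl

theorem rpow_half_sq (x : ℝ≥0∞) : (x ^ (1 / 2 : ℝ)) ^ 2 = x := by
  rw [← ENNReal.rpow_natCast, ← ENNReal.rpow_mul]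
  norm_num

/-- The weight is at least 1 for nonnegative exponents, so a finite norm puts the Fourier transform
in L², and the inverse transform supplies the function. -/
theorem exists_isGivenBy_of_prodNorm_lt_top {a b : ℝ} (ha : 0 ≤ a) (hb : 0 ≤ b)
    {T : 𝓢'(Plane, CPlane)} (h : prodNorm a b T < ∞) :
    ∃ f : Plane → CPlane, Measurable f ∧ MemLp f 2 volume ∧ IsGivenBy T f := by
  rw [prodNorm_eq] at h
  simp only [iInf_lt_iff] at h
  obtain ⟨g, hg, hlt⟩ := h
  refine exists_isGivenBy_of_fourier hg (memLp_two_of_weight ha hb hg.1 ?_)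
  exact lt_top_iff_ne_top.2 fun h2 => by simp [h2] at hlt

theorem IsFourierPair.diffNorm_eq_of_aestronglyMeasurable {f g : Plane → CPlane}
    (H : IsFourierPair f g) (hf : Measurable f) (a b : ℝ) :
    diffNorm a b (fun x y => f !₂[x, y]) =
      ∫⁻ ζ : Plane, (1 + fracSymbol a (ζ 0)) * (1 + fracSymbol b (ζ 1)) * ‖g ζ‖ₑ ^ 2 := by
  have hg := H.memLp_snd.1
  have e := hg.ae_eq_mk
  have H' : IsFourierPair f (hg.mk g) :=
    ⟨H.memLp_fst, H.memLp_snd.ae_eq e, fun φ => (H.integral_eq φ).trans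
      (integral_congr_ae (by filter_upwards [e] with x hx; rw [hx]))⟩
  rw [H'.diffNorm_eq hf hg.stronglyMeasurable_mk.measurable]
  refine lintegral_congr_ae ?_
  filter_upwards [e] with x hx
  rw [hx]

/-- The norm of `H_α^a H_β^b` is equivalent to the difference quotient norm. -/
theorem exists_prodNorm_bounds {a b : ℝ} (ha : 0 < a) (ha1 : a < 1) (hb : 0 < b) (hb1 : b < 1) :
    ∃ C : ℝ≥0, ∀ (T : 𝓢'(Plane, CPlane)) (f : Plane → CPlane), Measurable f → MemLp f 2 volume →
      IsGivenBy T f →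
      diffNorm a b (fun x y => f !₂[x, y]) ≤ C * prodNorm a b T ^ 2 ∧
        prodNorm a b T ^ 2 ≤ C * diffNorm a b (fun x y => f !₂[x, y]) := by
  obtain ⟨C, hC⟩ := exists_prodWeight_bounds ha ha1 hb hb1
  -- The summand 1 makes the constant nonzero, as needed for its inverse and for its product with ∞.
  refine ⟨1 + C, fun T f hf hf2 hT => ?_⟩
  have hC0 : ((1 + C : ℝ≥0) : ℝ≥0∞) ≠ 0 := by
    rw [ENNReal.coe_ne_zero]; positivity
  have hC1 : (C : ℝ≥0∞) ≤ ((1 + C : ℝ≥0) : ℝ≥0∞) := by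
    rw [ENNReal.coe_le_coe]; exact le_add_self
  constructor
  -- The norm is an infimum, so the lower bound must hold for every function that gives the Fourier
  -- transform; the upper bound needs only one such function.
  · have key : (((1 + C : ℝ≥0) : ℝ≥0∞)⁻¹ * diffNorm a b (fun x y => f !₂[x, y])) ^ (1 / 2 : ℝ) ≤
        prodNorm a b T := by
      rw [prodNorm_eq]
      refine le_iInf₂ fun g hg => ENNReal.rpow_le_rpow ?_ (by norm_num)
      rw [ENNReal.inv_mul_le_iff hC0 ENNReal.coe_ne_top]
      by_cases hfin : ∫⁻ ζ, prodWeight a b ζ * ‖g ζ‖ₑ ^ 2 < ∞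
      · have H := hT.isFourierPair hf2 hg (memLp_two_of_weight ha.le hb.le hg.1 hfin)
        rw [H.diffNorm_eq_of_aestronglyMeasurable hf, ← lintegral_const_mul' _ _ (by finiteness)]
        refine lintegral_mono fun ζ => ?_
        rw [← mul_assoc]
        exact mul_le_mul' ((hC ζ).2.trans (mul_le_mul' hC1 le_rfl)) le_rfl
      · rw [not_lt, top_le_iff] at hfin
        rw [hfin, ENNReal.mul_top hC0]
        exact le_top
    have := pow_le_pow_left' key 2
    rwa [rpow_half_sq, ENNReal.inv_mul_le_iff hC0 ENNReal.coe_ne_top] at this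
  · obtain ⟨g, hg, hg2, hgT⟩ := exists_isGivenBy_fourier hT hf2
    have H := hT.isFourierPair hf2 hgT hg2
    have h1 : prodNorm a b T ≤ (∫⁻ ζ, prodWeight a b ζ * ‖g ζ‖ₑ ^ 2) ^ (1 / 2 : ℝ) := by
      rw [prodNorm_eq]; exact iInf₂_le g hgT
    refine (pow_le_pow_left' h1 2).trans ?_
    rw [rpow_half_sq, H.diffNorm_eq hf hg, ← lintegral_const_mul' _ _ (by finiteness)]
    refine lintegral_mono fun ζ => ?_
    rw [← mul_assoc]
    exact mul_le_mul' ((hC ζ).1.trans (mul_le_mul' hC1 le_rfl)) le_rfl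

/-- The imaginary part of a coordinate. -/
noncomputable def imCoord (i : Fin 2) : CPlane →L[ℝ] ℝ :=
  Complex.imCLM.comp ((EuclideanSpace.proj (𝕜 := ℂ) i).restrictScalars ℝ)

theorem imCoord_apply (i : Fin 2) (z : CPlane) : imCoord i z = (z i).im := rfl

theorem imCoord_smul {c : ℂ} (hc : c.im = 0) (i : Fin 2) (z : CPlane) :
    imCoord i (c • z) = c.re * imCoord i z := by
  simp [imCoord_apply, hc]

theorem isReal_of_isGivenBy {T : 𝓢'(Plane, CPlane)} {f : Plane → Plane}
    (h : IsGivenBy T fun x => toCPlane (f x)) : IsReal T := by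
  intro φ hφ i
  rw [← imCoord_apply, (h.2 φ).2, ← ContinuousLinearMap.integral_comp_comm _ (h.2 φ).1]
  have : ∀ x, imCoord i (φ x • toCPlane (f x)) = 0 := fun x => by
    rw [imCoord_smul (hφ x)]
    simp [imCoord_apply, toCPlane]
  simp [this]

/-- Real smooth functions of compact support are admissible test functions, so the imaginary part
integrates to zero against all of them and vanishes by the fundamental lemma of the calculus of
variations. -/
theorem ae_imCoord_eq_zero {T : 𝓢'(Plane, CPlane)} (hT : IsReal T) {f : Plane → CPlane}
    (hf : MemLp f 2 volume) (h : IsGivenBy T f) (i : Fin 2) :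
    ∀ᵐ x, imCoord i (f x) = 0 := by
  have hloc : LocallyIntegrable (fun x => imCoord i (f x)) volume :=
    ((imCoord i).comp_memLp' hf).locallyIntegrable (by norm_num)
  refine ae_eq_zero_of_integral_contDiff_smul_eq_zero hloc fun g g_smooth g_cpt => ?_
  have hg₁ : HasCompactSupport (Complex.ofRealCLM ∘ g) := g_cpt.comp_left rfl
  have hg₂ : ContDiff ℝ (⊤ : ℕ∞) (Complex.ofRealCLM ∘ g) := by fun_prop
  set φ : 𝓢(Plane, ℂ) := hg₁.toSchwartzMap hg₂ with hφ
  have hφg : ∀ x, φ x = (g x : ℂ) := fun _ => rfl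
  have h1 := hT φ (fun x => by simp [hφg]) i
  rw [← imCoord_apply, (h.2 φ).2, ← ContinuousLinearMap.integral_comp_comm _ (h.2 φ).1] at h1
  rw [← h1]
  refine integral_congr_ae (.of_forall fun x => ?_)
  dsimp only
  rw [imCoord_smul (by simp [hφg]), hφg, Complex.ofReal_re, smul_eq_mul]

theorem exists_real_isGivenBy {a b : ℝ} (ha : 0 ≤ a) (hb : 0 ≤ b)
    {T : 𝓢'(Plane, CPlane)} (hT : IsReal T) (h : prodNorm a b T < ∞) :
    ∃ f : Plane → Plane, Measurable f ∧ MemLp f 2 volume ∧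
      IsGivenBy T fun x => toCPlane (f x) := by
  obtain ⟨F, hF, hF2, hTF⟩ := exists_isGivenBy_of_prodNorm_lt_top ha hb h
  set f : Plane → Plane := fun x => WithLp.toLp 2 fun i => (F x i).re with hf
  have mf : Measurable f := by
    refine (by fun_prop : Measurable (WithLp.toLp 2 : (Fin 2 → ℝ) → Plane)).comp ?_
    rw [measurable_pi_iff]
    intro i
    exact Complex.measurable_re.comp (by fun_prop)
  have e : F =ᵐ[volume] fun x => toCPlane (f x) := by
    filter_upwards [ae_imCoord_eq_zero hT hF2 hTF 0, ae_imCoord_eq_zero hT hF2 hTF 1] with x h0 h1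
    rw [imCoord_apply] at h0 h1
    ext i
    fin_cases i <;> apply Complex.ext <;> simp [toCPlane, hf, h0, h1]
  refine ⟨f, mf, ?_, hTF.congr e⟩
  refine hF2.of_le mf.aestronglyMeasurable ?_
  filter_upwards [e] with x hx
  rw [hx, norm_toCPlane]

theorem memLp_toCPlane {f : Plane → Plane} {p : ℝ≥0∞} (hf : MemLp f p volume) :
    MemLp (fun x => toCPlane (f x)) p volume :=
  hf.of_le (continuous_toCPlane.comp_aestronglyMeasurable hf.1)
    (.of_forall fun _ => (norm_toCPlane _).le)

theorem hNorm_sq (s δ : ℝ) (T : 𝓢'(Plane, CPlane)) :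
    hNorm s δ T ^ 2 = prodNorm s δ T ^ 2 + prodNorm δ s T ^ 2 := rpow_half_sq _

theorem ae_plane_of_ae_ae {p : Plane → Prop} (hp : MeasurableSet {z | p z})
    (h : ∀ᵐ x : ℝ, ∀ᵐ y : ℝ, p !₂[x, y]) : ∀ᵐ z, p z := by
  rw [ae_iff]
  change volume {z | p z}ᶜ = 0
  rw [← lintegral_indicator_one hp.compl, lintegral_plane (measurable_one.indicator hp.compl)]
  rw [← lintegral_zero (μ := (volume : Measure ℝ))]
  refine lintegral_congr_ae ?_
  filter_upwards [h] with x hx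
  rw [← lintegral_zero (μ := (volume : Measure ℝ))]
  refine lintegral_congr_ae ?_
  filter_upwards [hx] with y hy
  simp [hy]

end Distributions

/-! ### Composition estimates and L^∞ embedding for distributions. -/

/-- The quantitative composition estimate in `H_α^a H_β^b`. -/
theorem exists_prodNorm_comp_le {a b : ℝ} (ha : 1 / 2 < a) (ha1 : a < 1) (hb : 1 / 2 < b)
    (hb1 : b < 1) : ∃ C : ℝ≥0, ∀ (g : Plane → Plane) (M : ℝ≥0), Differentiable ℝ g →
      Differentiable ℝ (fderiv ℝ g) → (∀ x, ‖fderiv ℝ g x‖ ≤ M) →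
      (∀ x, ‖fderiv ℝ (fderiv ℝ g) x‖ ≤ M) → g 0 = 0 →
      ∀ (u v : 𝓢'(Plane, CPlane)) (f : Plane → Plane), Measurable f → MemLp f 2 volume →
      MemLp (fun x => g (f x)) 2 volume → IsGivenBy u (fun x => toCPlane (f x)) →
      IsGivenBy v (fun x => toCPlane (g (f x))) → ∀ H, prodNorm a b u ^ 2 ≤ H →
      prodNorm a b v ^ 2 ≤ C * M ^ 2 * H * (1 + H) := by
  obtain ⟨A, hA⟩ := exists_prodNorm_bounds (by linarith) ha1 (by linarith) hb1
  obtain ⟨C, hC⟩ := exists_diffNorm_comp_le Plane ha hb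
  refine ⟨A * C * A * (1 + A), fun g M hg hg' h1 h2 h0 u v f mf hf hgf hu hv H hH => ?_⟩
  have b1 := (hA u _ (continuous_toCPlane.measurable.comp mf) (memLp_toCPlane hf) hu).1
  have b2 := (hA v _ (continuous_toCPlane.measurable.comp (hg.continuous.measurable.comp mf))
    (memLp_toCPlane hgf) hv).2
  have b3 := hC g M hg hg' h1 h2 h0 _ (measurable_uncurry_of_plane mf)
  simp only [Function.comp_apply, diffNorm_toCPlane] at b1 b2
  set Q := diffNorm a b fun x y => f !₂[x, y]
  have b4 : Q ≤ A * H := b1.trans (by gcongr)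
  calc _ ≤ A * (C * M ^ 2 * (A * H) * (1 + A * H)) := b2.trans (by gcongr; exact b3.trans (by gcongr))
    _ ≤ A * (C * M ^ 2 * (A * H) * (1 + A * H)) + A * (C * M ^ 2 * (A * H) * (A + H)) :=
        le_self_add
    _ = _ := by push_cast; ring

set_option maxSynthPendingDepth 10 in
/-- The quantitative estimate in `H_α^a H_β^b` for the difference of two compositions. -/
theorem exists_prodNorm_comp_sub_comp_le {a b : ℝ} (ha : 1 / 2 < a) (ha1 : a < 1) (hb : 1 / 2 < b)
    (hb1 : b < 1) : ∃ C : ℝ≥0, ∀ (g : Plane → Plane) (M Ω : ℝ≥0), Differentiable ℝ g →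
      Differentiable ℝ (fderiv ℝ g) → Differentiable ℝ (fderiv ℝ (fderiv ℝ g)) →
      (∀ x, ‖fderiv ℝ g x‖ ≤ M) → (∀ x, ‖fderiv ℝ (fderiv ℝ g) x‖ ≤ M) →
      (∀ x, ‖fderiv ℝ (fderiv ℝ (fderiv ℝ g)) x‖ ≤ M) →
      ∀ (u₁ u₂ v : 𝓢'(Plane, CPlane)) (f₁ f₂ : Plane → Plane), Measurable f₁ → Measurable f₂ →
      MemLp f₁ 2 volume → MemLp f₂ 2 volume → MemLp (fun x => g (f₁ x) - g (f₂ x)) 2 volume →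
      (∀ x, ‖f₁ x - f₂ x‖ ≤ Ω) → IsGivenBy u₁ (fun x => toCPlane (f₁ x)) →
      IsGivenBy u₂ (fun x => toCPlane (f₂ x)) →
      IsGivenBy v (fun x => toCPlane (g (f₁ x) - g (f₂ x))) → ∀ H₁ H₂ W,
      prodNorm a b u₁ ^ 2 ≤ H₁ → prodNorm a b u₂ ^ 2 ≤ H₂ → prodNorm a b (u₂ - u₁) ^ 2 ≤ W →
      prodNorm a b v ^ 2 ≤ C * M ^ 2 * (W + Ω ^ 2) * (1 + (H₁ + H₂) + (H₁ + H₂) ^ 2) := by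
  obtain ⟨A, hA⟩ := exists_prodNorm_bounds (by linarith) ha1 (by linarith) hb1
  obtain ⟨C, hC⟩ := exists_diffNorm_comp_sub_comp_le Plane ha hb
  refine ⟨A * C * (1 + A) * (1 + A + A ^ 2), fun g M Ω hg hg' hg'' h1 h2 h3 u₁ u₂ v f₁ f₂ mf₁ mf₂
    hf₁ hf₂ hgf hΩ hu₁ hu₂ hv H₁ H₂ W hH₁ hH₂ hW => ?_⟩
  have hw : IsGivenBy (u₂ - u₁) fun x => toCPlane (f₂ x - f₁ x) := by
    simpa only [toCPlane_sub] using hu₂.sub hu₁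
  have b1 := (hA u₁ _ (continuous_toCPlane.measurable.comp mf₁) (memLp_toCPlane hf₁) hu₁).1
  have b2 := (hA u₂ _ (continuous_toCPlane.measurable.comp mf₂) (memLp_toCPlane hf₂) hu₂).1
  have b3 := (hA _ _ (continuous_toCPlane.measurable.comp (mf₂.sub mf₁))
    (memLp_toCPlane (hf₂.sub hf₁)) hw).1
  have b4 := (hA v _ (continuous_toCPlane.measurable.comp ((hg.continuous.measurable.comp mf₁).sub
    (hg.continuous.measurable.comp mf₂))) (memLp_toCPlane hgf) hv).2
  have b5 := hC g M Ω hg hg' hg'' h1 h2 h3 _ _ (measurable_uncurry_of_plane mf₁)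
    (measurable_uncurry_of_plane mf₂) fun x y => hΩ _
  simp only [Function.comp_apply, Pi.sub_apply, diffNorm_toCPlane] at b1 b2 b3 b4
  -- The distributional difference is u₂ - u₁, the pointwise estimate uses f₁ - f₂.
  rw [diffNorm_sub_comm] at b3
  set q := diffNorm a b fun x y => f₁ !₂[x, y] - f₂ !₂[x, y]
  set Q₁ := diffNorm a b fun x y => f₁ !₂[x, y]
  set Q₂ := diffNorm a b fun x y => f₂ !₂[x, y]
  have c1 : Q₁ ≤ A * H₁ := b1.trans (by gcongr)
  have c2 : Q₂ ≤ A * H₂ := b2.trans (by gcongr)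
  have c3 : q ≤ A * W := b3.trans (by gcongr)
  set S := H₁ + H₂ with hS
  have c4 : Q₁ + Q₂ ≤ A * S := by
    rw [hS, mul_add]; gcongr
  calc _ ≤ A * (C * M ^ 2 * (A * W + Ω ^ 2) * (1 + A * S + (A * S) ^ 2)) :=
        b4.trans (by gcongr; exact b5.trans (by gcongr))
    -- Padding that completes (1 + A)(W + Ω²) and (1 + A + A²)(1 + S + S²).
    _ ≤ A * (C * M ^ 2 * (A * W + Ω ^ 2 + (W + A * Ω ^ 2)) * (1 + A * S + (A * S) ^ 2 +
        (A + A ^ 2 + S + A ^ 2 * S + S ^ 2 + A * S ^ 2))) := by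
        exact mul_le_mul' le_rfl (mul_le_mul' (mul_le_mul' le_rfl le_self_add) le_self_add)
    _ = _ := by push_cast; ring

/-- The Sobolev embedding of `H_α^a H_β^b` in terms of distributions. -/
theorem exists_ae_enorm_sq_le_prodNorm {a b : ℝ} (ha : 1 / 2 < a) (ha1 : a < 1) (hb : 1 / 2 < b)
    (hb1 : b < 1) : ∃ C : ℝ≥0, ∀ (u : 𝓢'(Plane, CPlane)) (f : Plane → Plane), Measurable f →
      MemLp f 2 volume → IsGivenBy u (fun x => toCPlane (f x)) →
      ∀ᵐ x, ‖f x‖ₑ ^ 2 ≤ C * prodNorm a b u ^ 2 := by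
  obtain ⟨A, hA⟩ := exists_prodNorm_bounds (by linarith) ha1 (by linarith) hb1
  obtain ⟨K, hK⟩ := exists_ae_ae_enorm_sq_le Plane ha hb
  refine ⟨K * A, fun u f mf hf hu => ?_⟩
  have b1 := (hA u _ (continuous_toCPlane.measurable.comp mf) (memLp_toCPlane hf) hu).1
  simp only [Function.comp_apply, diffNorm_toCPlane] at b1
  refine ae_plane_of_ae_ae (measurableSet_le (by fun_prop) measurable_const) ?_
  filter_upwards [hK _ (measurable_uncurry_of_plane mf)] with x hx
  filter_upwards [hx] with y hy
  refine hy.trans ?_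
  rw [ENNReal.coe_mul, mul_assoc]
  gcongr

theorem add_sq_le_two_mul {x y : ℝ≥0∞} (hx : x ≠ ∞) (hy : y ≠ ∞) :
    (x + y) ^ 2 ≤ 2 * (x ^ 2 + y ^ 2) := by
  lift x to ℝ≥0 using hx
  lift y to ℝ≥0 using hy
  norm_cast
  exact add_sq_le

theorem measurable_prodWeight (a b : ℝ) : Measurable (prodWeight a b) := by
  unfold prodWeight japaneseBracket
  fun_prop

/-- This makes the norm of u₂ - u₁ finite, so that the sup bound Ω can be taken as a real number. -/
theorem prodNorm_sub_lt_top {a b : ℝ} {T T' : 𝓢'(Plane, CPlane)} (h : prodNorm a b T < ∞)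
    (h' : prodNorm a b T' < ∞) : prodNorm a b (T - T') < ∞ := by
  rw [prodNorm_eq] at *
  simp only [iInf_lt_iff] at *
  obtain ⟨g, hg, h⟩ := h
  obtain ⟨g', hg', h'⟩ := h'
  refine ⟨fun ζ => g ζ - g' ζ, hg.sub hg', ENNReal.rpow_lt_top_of_nonneg (by norm_num) ?_⟩
  have hf : ∀ {x : ℝ≥0∞}, x ^ (1 / 2 : ℝ) < ∞ → x ≠ ∞ := fun h h2 => by simp [h2] at h
  have hm : AEMeasurable (fun ζ => prodWeight a b ζ * ‖g ζ‖ₑ ^ 2) :=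
    (measurable_prodWeight a b).aemeasurable.mul (hg.1.enorm.pow_const 2)
  refine ne_top_of_le_ne_top (b := 2 * ((∫⁻ ζ, prodWeight a b ζ * ‖g ζ‖ₑ ^ 2) +
    ∫⁻ ζ, prodWeight a b ζ * ‖g' ζ‖ₑ ^ 2))
    (ENNReal.mul_ne_top ENNReal.ofNat_ne_top (ENNReal.add_ne_top.2 ⟨hf h, hf h'⟩)) ?_
  rw [← lintegral_add_left' hm, ← lintegral_const_mul' _ _ ENNReal.ofNat_ne_top]
  refine lintegral_mono fun ζ => ?_
  calc prodWeight a b ζ * ‖g ζ - g' ζ‖ₑ ^ 2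
      ≤ prodWeight a b ζ * (2 * (‖g ζ‖ₑ ^ 2 + ‖g' ζ‖ₑ ^ 2)) := by
        gcongr
        exact (pow_le_pow_left' enorm_sub_le 2).trans (add_sq_le_two_mul enorm_ne_top enorm_ne_top)
    _ = _ := by ring

theorem hNorm_lt_top_iff {s δ : ℝ} {T : 𝓢'(Plane, CPlane)} :
    hNorm s δ T < ∞ ↔ prodNorm s δ T < ∞ ∧ prodNorm δ s T < ∞ := by
  have h : hNorm s δ T < ∞ ↔ hNorm s δ T ^ 2 < ∞ := by simp [ENNReal.pow_lt_top_iff]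
  rw [h, hNorm_sq]
  simp [ENNReal.pow_lt_top_iff]

theorem hNorm_sub_lt_top {s δ : ℝ} {T T' : 𝓢'(Plane, CPlane)} (h : hNorm s δ T < ∞)
    (h' : hNorm s δ T' < ∞) : hNorm s δ (T - T') < ∞ := by
  rw [hNorm_lt_top_iff] at *
  exact ⟨prodNorm_sub_lt_top h.1 h'.1, prodNorm_sub_lt_top h.2 h'.2⟩

theorem MemH.prodNorm_lt_top {s δ : ℝ} {T : 𝓢'(Plane, CPlane)} (h : MemH s δ T) :
    prodNorm s δ T < ∞ :=
  (hNorm_lt_top_iff.1 h.2).1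

theorem hNorm_lt_top_of_sq {s δ : ℝ} {T : 𝓢'(Plane, CPlane)} (h : hNorm s δ T ^ 2 < ∞) :
    hNorm s δ T < ∞ :=
  lt_top_iff_ne_top.2 fun h2 => by simp [h2] at h

theorem memLp_comp_sub_comp {g : Plane → Plane} {M : ℝ≥0} (hg : Differentiable ℝ g)
    (h1 : ∀ x, ‖fderiv ℝ g x‖ ≤ M) {f₁ f₂ : Plane → Plane}
    (hf₁ : MemLp f₁ 2 volume) (hf₂ : MemLp f₂ 2 volume) :
    MemLp (fun x => g (f₁ x) - g (f₂ x)) 2 volume :=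
  (hf₁.sub hf₂).of_le_mul (c := M)
    ((hg.continuous.comp_aestronglyMeasurable hf₁.1).sub
      (hg.continuous.comp_aestronglyMeasurable hf₂.1))
    (.of_forall fun _ => norm_sub_le_of_fderiv hg h1 _ _)

end ProductSobolev

/-! ### The two estimates in ℍ^{s,δ}. -/

theorem proposition4p2 (s δ : ℝ) (hδ : 3 / 4 < δ) (hδs : δ ≤ s) (hs : s < 1) :
    ∃ C₁ C₂ : ℝ≥0 → ℝ≥0, ∀ σ : Plane → Plane, MemCb 3 σ →
      (σ 0 = 0 → ∀ u : 𝓢'(Plane, CPlane), MemH s δ u →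
        ∃ v : 𝓢'(Plane, CPlane), IsComposition σ u v ∧ MemH s δ v ∧
          hNorm s δ v ^ 2 ≤
            C₁ (cbNorm 2 σ).toNNReal * hNorm s δ u ^ 2 * (1 + hNorm s δ u ^ 2)) ∧
      (∀ u₁ u₂ : 𝓢'(Plane, CPlane), MemH s δ u₁ → MemH s δ u₂ →
        ∃ v₁ v₂ : 𝓢'(Plane, CPlane), IsComposition σ u₁ v₁ ∧ IsComposition σ u₂ v₂ ∧
          MemH s δ (v₁ - v₂) ∧
          hNorm s δ (v₁ - v₂) ^ 2 ≤
            C₂ (cbNorm 3 σ).toNNReal * hNorm s δ (u₂ - u₁) ^ 2 *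
              (1 + ∑ k ∈ Finset.Icc 1 2, (hNorm s δ u₁ ^ (2 * k) + hNorm s δ u₂ ^ (2 * k)))) := by
  have hδ' : 1 / 2 < δ := by linarith
  have hs' : 1 / 2 < s := by linarith
  have hδ1 : δ < 1 := by linarith
  obtain ⟨A₁, hA₁⟩ := exists_prodNorm_comp_le hs' hs hδ' hδ1
  obtain ⟨A₂, hA₂⟩ := exists_prodNorm_comp_le hδ' hδ1 hs' hs
  obtain ⟨B₁, hB₁⟩ := exists_prodNorm_comp_sub_comp_le hs' hs hδ' hδ1
  obtain ⟨B₂, hB₂⟩ := exists_prodNorm_comp_sub_comp_le hδ' hδ1 hs' hs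
  obtain ⟨K, hK⟩ := exists_ae_enorm_sq_le_prodNorm hs' hs hδ' hδ1
  -- The two orders of (s, δ) are added. In the second constant, 1 + K comes from W + Ω² with Ω² = K
  -- W, and 2 from (H₁ + H₂)² ≤ 2(H₁² + H₂²).
  refine ⟨fun m => (A₁ + A₂) * m ^ 2, fun m => 2 * (B₁ + B₂) * (1 + K) * m ^ 2,
    fun σ hσ => ⟨fun h0 u hu => ?_, fun u₁ u₂ hu₁ hu₂ => ?_⟩⟩
  all_goals
    have hd : Differentiable ℝ σ := hσ.1.differentiable (by norm_num)
    have c1 : ContDiff ℝ 2 (fderiv ℝ σ) := hσ.1.fderiv_right (by norm_num)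
    have hd' : Differentiable ℝ (fderiv ℝ σ) := c1.differentiable (by norm_num)
  · have hcb : cbNorm 2 σ < ∞ := (cbNorm_mono σ (by norm_num)).trans_lt hσ.2
    have h1 := norm_fderiv_le_of_memCb hcb (by norm_num)
    have h2 := norm_fderiv_fderiv_le_of_memCb hcb le_rfl
    set M := (cbNorm 2 σ).toNNReal
    obtain ⟨f, mf, hf, huf⟩ := exists_real_isGivenBy (by linarith) (by linarith) hu.1
      hu.prodNorm_lt_top
    -- Since σ 0 = 0, σ∘f is the difference of the compositions with f and with the zero function.
    have hσf : MemLp (fun x => σ (f x)) 2 volume := by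
      simpa [h0] using memLp_comp_sub_comp hd h1 hf (MemLp.zero' (p := 2))
    have hv := isGivenBy_of_memLp_two (memLp_toCPlane hσf)
    set v := Lp.toTemperedDistribution ((memLp_toCPlane hσf).toLp _)
    set H := hNorm s δ u ^ 2 with hH
    have hH' := hNorm_sq s δ u
    have key : hNorm s δ v ^ 2 ≤ ((A₁ + A₂) * M ^ 2 : ℝ≥0) * H * (1 + H) := by
      rw [hNorm_sq]
      refine (add_le_add
        (hA₁ σ M hd hd' h1 h2 h0 u v f mf hf hσf huf hv H (by rw [hH, hH']; exact le_self_add))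
        (hA₂ σ M hd hd' h1 h2 h0 u v f mf hf hσf huf hv H
          (by rw [hH, hH']; exact le_add_self))).trans (le_of_eq ?_)
      push_cast; ring
    have hHf : H < ∞ := ENNReal.pow_lt_top hu.2
    exact ⟨v, ⟨f, mf.aestronglyMeasurable, huf, hv⟩, ⟨isReal_of_isGivenBy hv,
      hNorm_lt_top_of_sq (key.trans_lt (ENNReal.mul_lt_top
        (ENNReal.mul_lt_top ENNReal.coe_lt_top hHf)
        (ENNReal.add_lt_top.2 ⟨ENNReal.one_lt_top, hHf⟩)))⟩, key⟩
  · have hcb := hσ.2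
    have c2 : ContDiff ℝ 1 (fderiv ℝ (fderiv ℝ σ)) := c1.fderiv_right (by norm_num)
    have hd'' : Differentiable ℝ (fderiv ℝ (fderiv ℝ σ)) := c2.differentiable (by norm_num)
    have h1 := norm_fderiv_le_of_memCb hcb (by norm_num)
    have h2 := norm_fderiv_fderiv_le_of_memCb hcb (by norm_num)
    have h3 := norm_fderiv_fderiv_fderiv_le_of_memCb hcb le_rfl
    set M := (cbNorm 3 σ).toNNReal
    obtain ⟨f₀, mf₀, hf₀, huf₀⟩ := exists_real_isGivenBy (by linarith) (by linarith) hu₁.1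
      hu₁.prodNorm_lt_top
    obtain ⟨f₂, mf₂, hf₂, huf₂⟩ := exists_real_isGivenBy (by linarith) (by linarith) hu₂.1
      hu₂.prodNorm_lt_top
    set H₁ := hNorm s δ u₁ ^ 2 with hH₁
    set H₂ := hNorm s δ u₂ ^ 2 with hH₂
    set W := hNorm s δ (u₂ - u₁) ^ 2 with hW
    have hH₁' := hNorm_sq s δ u₁
    have hH₂' := hNorm_sq s δ u₂
    have hW' := hNorm_sq s δ (u₂ - u₁)
    have hH₁f : H₁ < ∞ := ENNReal.pow_lt_top hu₁.2
    have hH₂f : H₂ < ∞ := ENNReal.pow_lt_top hu₂.2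
    have hWf : W < ∞ := ENNReal.pow_lt_top (hNorm_sub_lt_top hu₂.2 hu₁.2)
    have hw : IsGivenBy (u₂ - u₁) fun x => toCPlane (f₂ x - f₀ x) := by
      simpa only [toCPlane_sub] using huf₂.sub huf₀
    have hae := hK (u₂ - u₁) _ (mf₂.sub mf₀) (hf₂.sub hf₀) hw
    set Ω : ℝ≥0 := NNReal.sqrt (K * W).toNNReal with hΩ
    have hΩ2 : (Ω : ℝ≥0∞) ^ 2 = K * W := by
      rw [hΩ, ← ENNReal.coe_pow, NNReal.sq_sqrt, ENNReal.coe_toNNReal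
        (ENNReal.mul_ne_top ENNReal.coe_ne_top hWf.ne)]
    classical
    -- The embedding bounds f₀ - f₂ only almost everywhere, while the difference estimate asks for a
    -- bound at every point. Replacing f₀ by f₂ on the exceptional null set changes no distribution.
    set f₁ : Plane → Plane := fun x => if ‖f₀ x - f₂ x‖ ≤ Ω then f₀ x else f₂ x with hf₁def
    have mf₁ : Measurable f₁ :=
      Measurable.ite (measurableSet_le (mf₀.sub mf₂).norm measurable_const) mf₀ mf₂
    have e₁ : f₀ =ᵐ[volume] f₁ := by
      filter_upwards [hae] with x hx
      have h4 : ‖f₂ x - f₀ x‖ₑ ^ 2 ≤ (Ω : ℝ≥0∞) ^ 2 := by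
        rw [hΩ2]
        refine hx.trans ?_
        gcongr
        rw [hW, hW']; exact le_self_add
      have h5 : ‖f₂ x - f₀ x‖ₑ ≤ Ω := (ENNReal.pow_le_pow_left_iff two_ne_zero).1 h4
      have h6 : ‖f₀ x - f₂ x‖ ≤ Ω := by
        rw [norm_sub_rev]
        rw [enorm_eq_nnnorm, ENNReal.coe_le_coe] at h5
        exact h5
      simp only [hf₁def]
      rw [if_pos h6]
    have hf₁ : MemLp f₁ 2 volume := hf₀.ae_eq e₁
    have huf₁ : IsGivenBy u₁ fun x => toCPlane (f₁ x) :=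
      huf₀.congr (by filter_upwards [e₁] with x hx; rw [hx])
    have hbd : ∀ x, ‖f₁ x - f₂ x‖ ≤ Ω := by
      intro x
      simp only [hf₁def]
      split_ifs with h
      · exact h
      · simp
    -- Without σ 0 = 0 the compositions are realised separately as L^∞ distributions; only their
    -- difference is square integrable in general.
    have htop : ∀ {f : Plane → Plane}, Measurable f → MemLp (fun x => σ (f x)) ∞ volume :=
      fun hf => memLp_top_of_bound (hd.continuous.measurable.comp hf).aestronglyMeasurable M
        (.of_forall fun x => by
          simpa using norm_iteratedFDeriv_le_of_memCb hcb (j := 0) (by norm_num) _)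
    have hv₁ := isGivenBy_of_memLp_top (memLp_toCPlane (htop mf₁))
    have hv₂ := isGivenBy_of_memLp_top (memLp_toCPlane (htop mf₂))
    set v₁ := Lp.toTemperedDistribution ((memLp_toCPlane (htop mf₁)).toLp _)
    set v₂ := Lp.toTemperedDistribution ((memLp_toCPlane (htop mf₂)).toLp _)
    have hv : IsGivenBy (v₁ - v₂) fun x => toCPlane (σ (f₁ x) - σ (f₂ x)) := by
      simpa only [toCPlane_sub] using hv₁.sub hv₂
    have hσf := memLp_comp_sub_comp hd h1 hf₁ hf₂
    have hsum : ∑ k ∈ Finset.Icc 1 2, (hNorm s δ u₁ ^ (2 * k) + hNorm s δ u₂ ^ (2 * k)) =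
        (H₁ + H₂) + (H₁ ^ 2 + H₂ ^ 2) := by
      rw [show Finset.Icc 1 2 = {1, 2} from rfl, Finset.sum_pair (by norm_num)]
      simp only [pow_mul, pow_one, hH₁, hH₂]
    have key : hNorm s δ (v₁ - v₂) ^ 2 ≤ (2 * (B₁ + B₂) * (1 + K) * M ^ 2 : ℝ≥0) * W *
        (1 + ∑ k ∈ Finset.Icc 1 2, (hNorm s δ u₁ ^ (2 * k) + hNorm s δ u₂ ^ (2 * k))) := by
      rw [hsum, hNorm_sq]
      refine (add_le_add
        (hB₁ σ M Ω hd hd' hd'' h1 h2 h3 u₁ u₂ _ f₁ f₂ mf₁ mf₂ hf₁ hf₂ hσf hbd huf₁ huf₂ hv H₁ H₂ W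
          (by rw [hH₁, hH₁']; exact le_self_add) (by rw [hH₂, hH₂']; exact le_self_add)
          (by rw [hW, hW']; exact le_self_add))
        (hB₂ σ M Ω hd hd' hd'' h1 h2 h3 u₁ u₂ _ f₁ f₂ mf₁ mf₂ hf₁ hf₂ hσf hbd huf₁ huf₂ hv H₁ H₂ W
          (by rw [hH₁, hH₁']; exact le_add_self) (by rw [hH₂, hH₂']; exact le_add_self)
          (by rw [hW, hW']; exact le_add_self))).trans ?_
      rw [hΩ2]
      have hsq : (H₁ + H₂) ^ 2 ≤ 2 * (H₁ ^ 2 + H₂ ^ 2) :=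
        add_sq_le_two_mul hH₁f.ne hH₂f.ne
      calc _ = (B₁ + B₂) * M ^ 2 * ((1 + K) * W) * (1 + (H₁ + H₂) + (H₁ + H₂) ^ 2) := by ring
        _ ≤ (B₁ + B₂) * M ^ 2 * ((1 + K) * W) *
            (2 * (1 + (H₁ + H₂)) + 2 * (H₁ ^ 2 + H₂ ^ 2)) := by
          gcongr
          exact le_mul_of_one_le_left' one_le_two
        _ = _ := by push_cast; ring
    refine ⟨v₁, v₂, ⟨f₁, mf₁.aestronglyMeasurable, huf₁, hv₁⟩,
      ⟨f₂, mf₂.aestronglyMeasurable, huf₂, hv₂⟩, ⟨isReal_of_isGivenBy hv,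
      hNorm_lt_top_of_sq (key.trans_lt ?_)⟩, key⟩
    rw [hsum]
    exact ENNReal.mul_lt_top (ENNReal.mul_lt_top ENNReal.coe_lt_top hWf) (ENNReal.add_lt_top.2
      ⟨ENNReal.one_lt_top, ENNReal.add_lt_top.2 ⟨ENNReal.add_lt_top.2 ⟨hH₁f, hH₂f⟩,
        ENNReal.add_lt_top.2 ⟨ENNReal.pow_lt_top hH₁f, ENNReal.pow_lt_top hH₂f⟩⟩⟩)
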